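/- Let $\mathbb{O}$ be the real algebra of octonions, with conjugation $x\mapsto x^c$, trace $t(x)=x+x^c$, norm $n(x)=xx^c=|x|^2$, $\mathrm{im}(x)=x-t(x)/2$, and let $\mathbb{S}=\{J\in\mathbb{O}: t(J)=0,\ n(J)=1\}$ be the sphere of imaginary units. Let $D\subseteq\mathbb{C}$ be open, invariant under complex conjugation and disjoint from $\mathbb{R}$, such that $D^+=\{z\in D:\mathrm{Im}\,z>0\}$ is non-empty and connected, and let $\Omega_D=\{\alpha+\beta J: \alpha+i\beta\in D,\ J\in\mathbb{S}\}$. A function $f:\Omega_D\to\mathbb{O}$ is *slice regular* if $f(\alpha+\beta J)=F_1(\alpha+i\beta)+J F_2(\alpha+i\beta)$ for all $\alpha+i\beta\in D$, $J\in\mathbb{S}$, where $F=F_1+\imath F_2:D\to\mathbb{O}\otimes_{\mathbb{R}}\mathbb{C}$ is $C^1$, $F(\bar z)=\overline{F(z)}$, and $\partial F/\partial\bar z\equiv0$; then $F$ is unique, and we write $f=\mathcal{I}(F)$. Put $f'_c=\mathcal{I}(\partial F/\partial z)$, $N(f)=\mathcal{I}(FF^c)$, $f^\circ_s(x)=\frac12(f(x)+f(x^c))$,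 $f'_s(x)=\frac12\,\mathrm{im}(x)^{-1}(f(x)-f(x^c))$, $D_f=\{x\in\Omega_D: f'_s(x)=0\}$, and $\Delta_y(x)=x^2-x\,t(y)+n(y)$. Let $f:\Omega_D\to\mathbb{O}$ be a nonconstant slice regular function and let $c\in f(\Omega_D)$ be such that $N(f-c)\equiv0$ (that is, $f$ admits a wing $W_{f,c}$). Fix $I\in\mathbb{S}$ and, for $\alpha+i\beta\in D^+$, set $$\omega(\alpha+i\beta)=\alpha+(c-f^\circ_s(\alpha+\beta I))\,f'_s(\alpha+\beta I)^{-1}\quad\text{if } f'_s(\alpha+\beta I)\neq0,$$ $$\omega(\alpha+i\beta)=\alpha-h^\circ_s(\alpha+\beta I)\,h'_s(\alpha+\beta I)^{-1}\quad\text{if } f'_s(\alpha+\beta I)=0,$$ where in the second case $f(x)=c+\Delta_{\alpha+\beta I}(x)^n\,h(x)$ on $\Omega_D$ with $n>0$ and $h$ slice regular on $\Omega_D$, not identically zero on $\alpha+\beta\mathbb{S}$. Let $W_{f,c}=\omega(D^+)$. In the second case such $n,h$ always exist; $\omega$ is a well-defined map $D^+\to\Omega_D$, independent of $I$ and of the choice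 of $n,h$; moreover $f\equiv c$ on $W_{f,c}$ and $f^{-1}(c)\setminus D_f=W_{f,c}\setminus D_f$. Furthermore: 1. $\omega$ is a real analytic embedding, and for each $\alpha_0+i\beta_0\in D^+$ the wing $W_{f,c}$ meets the sphere $\alpha_0+\beta_0\mathbb{S}$ exactly at the point $\omega(\alpha_0+i\beta_0)$, and transversally there. 2. Let $x_0=\alpha_0+\beta_0J\in W_{f,c}$ with $\alpha_0+i\beta_0\in D^+$, $J\in\mathbb{S}$. Set $a=f'_c(x_0)$, $b=f'_s(x_0)$ if $x_0\notin D_f$, and $a=h'_c(x_0)$, $b=h'_s(x_0)$ if $x_0\in D_f$ and $f(x)=c+\Delta_{x_0}(x)^n\,h(x)$ with $n>0$ and $h$ slice regular on $\Omega_D$, not identically zero on $\alpha_0+\beta_0\mathbb{S}$. Then $a,b$ are well defined, $b\neq0$, $a\neq b$, the tangent space $T_{x_0}W_{f,c}$ is the image of $d\omega_{\alpha_0+i\beta_0}$, and $d\omega_{\alpha_0+i\beta_0}$ maps the vectors $1,i$ to $1-ab^{-1},\ J-(Ja)b^{-1}\in T_{x_0}W_{f,c}$. 3. With the same notation, let $\mathcal{J}_{x_0}$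 be the restriction of $R_{b^{-1}}\circ L_J\circ R_b: v\mapsto (J(vb))b^{-1}$ to $T_{x_0}W_{f,c}$. Then $\mathcal{J}_{x_0}$ maps $T_{x_0}W_{f,c}$ to itself and $\mathcal{J}_{x_0}^2=-1$; the $\mathcal{J}$-holomorphic charts make $(W_{f,c},\mathcal{J})$ a Riemann surface, and $\omega$ is a biholomorphism from $(D^+,i)$ onto $(W_{f,c},\mathcal{J})$; in particular $d\omega\circ i=\mathcal{J}\circ d\omega$. -/

import Mathlib

/-! ### The octonions, by the Cayley-Dickson construction `𝕆 = ℍ + ℓ ℍ` -/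

/-- The octonions: `ℍ × ℍ` with the Euclidean norm of `ℝ⁸`; the pair `(α, β)` is `α + ℓ β`. -/
def Octonion : Type := WithLp 2 (Quaternion ℝ × Quaternion ℝ)

namespace Octonion

noncomputable instance : NormedAddCommGroup Octonion :=
  inferInstanceAs (NormedAddCommGroup (WithLp 2 (Quaternion ℝ × Quaternion ℝ)))

noncomputable instance : InnerProductSpace ℝ Octonion :=
  inferInstanceAs (InnerProductSpace ℝ (WithLp 2 (Quaternion ℝ × Quaternion ℝ)))

/-- The octonion `α + ℓ β`. -/
def mk (α β : Quaternion ℝ) : Octonion := WithLp.toLp 2 (α, β)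

/-- The component `α` of `α + ℓ β`. -/
def fst (x : Octonion) : Quaternion ℝ := (WithLp.ofLp x).1

/-- The component `β` of `α + ℓ β`. -/
def snd (x : Octonion) : Quaternion ℝ := (WithLp.ofLp x).2

@[ext] theorem ext {x y : Octonion} (h1 : x.fst = y.fst) (h2 : x.snd = y.snd) : x = y :=
  WithLp.ofLp_injective 2 (Prod.ext h1 h2)

@[simp] theorem fst_mk (α β : Quaternion ℝ) : (mk α β).fst = α := rfl
@[simp] theorem snd_mk (α β : Quaternion ℝ) : (mk α β).snd = β := rfl
@[simp] theorem fst_zero : (0 : Octonion).fst = 0 := rfl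
@[simp] theorem snd_zero : (0 : Octonion).snd = 0 := rfl
@[simp] theorem fst_add (x y : Octonion) : (x + y).fst = x.fst + y.fst := rfl
@[simp] theorem snd_add (x y : Octonion) : (x + y).snd = x.snd + y.snd := rfl

/-- `(α + ℓ β)(γ + ℓ δ) = (α γ - δ β^c) + ℓ (α^c δ + γ β)`. -/
noncomputable instance : Mul Octonion :=
  ⟨fun x y => mk (x.fst * y.fst - y.snd * star x.snd) (star x.fst * y.snd + y.fst * x.snd)⟩

noncomputable instance : One Octonion := ⟨mk 1 0⟩

@[simp] theorem fst_mul (x y : Octonion) :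
    (x * y).fst = x.fst * y.fst - y.snd * star x.snd := rfl
@[simp] theorem snd_mul (x y : Octonion) :
    (x * y).snd = star x.fst * y.snd + y.fst * x.snd := rfl
@[simp] theorem fst_one : (1 : Octonion).fst = 1 := rfl
@[simp] theorem snd_one : (1 : Octonion).snd = 0 := rfl

noncomputable instance : NonAssocRing Octonion :=
  { (inferInstance : AddCommGroup Octonion), (inferInstance : Mul Octonion),
    (inferInstance : One Octonion) with
    left_distrib := fun x y z => by
      ext1 <;> simp only [fst_mul, snd_mul, fst_add, snd_add, mul_add, add_mul] <;> abel
    right_distrib := fun x y z => by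
      ext1 <;> simp only [fst_mul, snd_mul, fst_add, snd_add, mul_add, add_mul, star_add] <;> abel
    zero_mul := fun x => by ext1 <;> simp
    mul_zero := fun x => by ext1 <;> simp
    one_mul := fun x => by ext1 <;> simp
    mul_one := fun x => by ext1 <;> simp }

/-- The conjugation `x ↦ x^c`: `(α + ℓ β)^c = α^c - ℓ β`. -/
noncomputable instance : Star Octonion := ⟨fun x => mk (star x.fst) (-x.snd)⟩

/-- `x⁻¹ = n(x)⁻¹ x^c`, where `n(x) = ‖x‖²` (and `0⁻¹ = 0`). -/
noncomputable instance : Inv Octonion := ⟨fun x => (‖x‖ ^ 2)⁻¹ • star x⟩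

/-- The real part, as a real number. -/
def re (x : Octonion) : ℝ := x.fst.re

/-- The imaginary part `im(x) = x - re(x)`. -/
noncomputable def im (x : Octonion) : Octonion := x - x.re • (1 : Octonion)

/-- Powers `xⁿ`. -/
noncomputable def npow (x : Octonion) : ℕ → Octonion
  | 0 => 1
  | n + 1 => npow x n * x

/-- The sphere `𝕊` of imaginary units: trace `0` and norm `1`. -/
def imUnits : Set Octonion := {x | x + star x = 0 ∧ x * star x = 1}

end Octonion

/-! ### Slice functions -/

/-- The complexification `𝕆 + ι 𝕆`; the pair `(x, y)` is `x + ι y`. -/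
abbrev OctonionC : Type := Octonion × Octonion

namespace Slice

open Octonion

/-- `φ_J : ℂ → ℂ_J`, `α + iβ ↦ α + β J`. -/
noncomputable def phi (J : Octonion) (z : ℂ) : Octonion := z.re • (1 : Octonion) + z.im • J

/-- `φ_J` on the complexification: `x + ι y ↦ x + J y`. -/
noncomputable def phiC (J : Octonion) (w : OctonionC) : Octonion := w.1 + J * w.2

/-- `(x + ι y)(x' + ι y') = (x x' - y y') + ι (x y' + y x')`. -/
noncomputable def mulC (w w' : OctonionC) : OctonionC :=
  (w.1 * w'.1 - w.2 * w'.2, w.1 * w'.2 + w.2 * w'.1)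

/-- `(x + ι y)^c = x^c + ι y^c`. -/
noncomputable def starC (w : OctonionC) : OctonionC := (star w.1, star w.2)

/-- The complex conjugate of `x + ι y`, namely `x - ι y`. -/
noncomputable def barC (w : OctonionC) : OctonionC := (w.1, -w.2)

/-- Multiplication by `ι`. -/
noncomputable def iotaC (w : OctonionC) : OctonionC := (-w.2, w.1)

/-- The circularization `Ω_D` of `D`. -/
def circ (D : Set ℂ) : Set Octonion := {x | ∃ z ∈ D, ∃ J ∈ imUnits, x = phi J z}

/-- The sphere `α + β 𝕊`, for `z = α + iβ`. -/
def sphere (z : ℂ) : Set Octonion := {x | ∃ J ∈ imUnits, x = phi J z}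

/-- `F` is a stem function on `D`. -/
def IsStem (D : Set ℂ) (F : ℂ → OctonionC) : Prop :=
  ∀ z ∈ D, F ((starRingEnd ℂ) z) = barC (F z)

/-- `f` is the slice function on `Ω_D` induced by `F`: `f ∘ φ_J = φ_J ∘ F` for all `J`. -/
def Induces (D : Set ℂ) (F : ℂ → OctonionC) (f : Octonion → Octonion) : Prop :=
  ∀ z ∈ D, ∀ J ∈ imUnits, f (phi J z) = phiC J (F z)

/-- `F` is continuously differentiable with `∂F/∂α + ι ∂F/∂β = 0` on the open set `D`. -/
def HolomorphicStem (D : Set ℂ) (F : ℂ → OctonionC) : Prop :=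
  ContDiffOn ℝ 1 F D ∧ ∀ z ∈ D, fderiv ℝ F z 1 + iotaC (fderiv ℝ F z Complex.I) = 0

/-- `f` is slice regular on `Ω_D` (for `D` open). Only the values of `f` on `Ω_D` matter. -/
def SliceRegular (D : Set ℂ) (f : Octonion → Octonion) : Prop :=
  ∃ F : ℂ → OctonionC, IsStem D F ∧ Induces D F f ∧ HolomorphicStem D F

/-- The stem function that induces the slice function `f` (unique on `D`). -/
noncomputable def stemFn (D : Set ℂ) (f : Octonion → Octonion) : ℂ → OctonionC :=
  Classical.epsilon fun F => IsStem D F ∧ Induces D F f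

/-- The slice function induced by a stem function: at `x = α + β J` with `β = |im x|` and
`J = im x / |im x|` its value is `φ_J (F (α + iβ))`. -/
noncomputable def induce (F : ℂ → OctonionC) (x : Octonion) : Octonion :=
  phiC (‖x.im‖⁻¹ • x.im) (F ⟨x.re, ‖x.im‖⟩)

/-- The normal function `N(f)`, induced by `F F^c`. -/
noncomputable def normalFn (D : Set ℂ) (f : Octonion → Octonion) : Octonion → Octonion :=
  induce fun z => mulC (stemFn D f z) (starC (stemFn D f z))

/-- The slice derivative `f'_c`, induced by `∂F/∂z = (∂F/∂α - ι ∂F/∂β) / 2`. -/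
noncomputable def sliceDeriv (D : Set ℂ) (f : Octonion → Octonion) : Octonion → Octonion :=
  induce fun z => (1 / 2 : ℝ) •
    (fderiv ℝ (stemFn D f) z 1 - iotaC (fderiv ℝ (stemFn D f) z Complex.I))

/-- The spherical value. -/
noncomputable def sphValue (f : Octonion → Octonion) (x : Octonion) : Octonion :=
  (1 / 2 : ℝ) • (f x + f (star x))

/-- The spherical derivative `f'_s`. -/
noncomputable def sphDeriv (f : Octonion → Octonion) (x : Octonion) : Octonion :=
  (1 / 2 : ℝ) • ((im x)⁻¹ * (f x - f (star x)))

/-- The degenerate set `D_f`, the zero set of `f'_s` in `Ω_D` minus the reals. -/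
def degSet (D : Set ℂ) (f : Octonion → Octonion) : Set Octonion :=
  {x | x ∈ circ D ∧ im x ≠ 0 ∧ sphDeriv f x = 0}

/-- `Δ_y(x) = x² - x t(y) + n(y)`. -/
noncomputable def Delta (y x : Octonion) : Octonion :=
  x * x - x * (y + star y) + y * star y

/-! ### Product domains and wings -/

/-- `D⁺`, the part of `D` in the open upper half-plane. -/
def upper (D : Set ℂ) : Set ℂ := {z | z ∈ D ∧ 0 < z.im}

/-- `Ω_D` is a product domain: `D` is open, invariant under complex conjugation, does not meet the
real line, and `D⁺` is nonempty and connected (so `D` has the two components `D⁺`, `D⁻`). -/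
structure IsProductBase (D : Set ℂ) : Prop where
  isOpen : IsOpen D
  conj_mem : ∀ z ∈ D, (starRingEnd ℂ) z ∈ D
  im_ne_zero : ∀ z ∈ D, z.im ≠ 0
  connected : IsConnected (upper D)

theorem isOpen_upper {D : Set ℂ} (hD : IsOpen D) : IsOpen (upper D) :=
  hD.inter (isOpen_lt continuous_const Complex.continuous_im)

/-- `D⁺` as an open subset of `ℂ`; as such it is a Riemann surface. -/
def upperOpens {D : Set ℂ} (hD : IsProductBase D) : TopologicalSpace.Opens ℂ :=
  ⟨upper D, isOpen_upper hD.isOpen⟩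

/-- `f` is a nonconstant slice regular function on `Ω_D` that takes the value `c` and has
`N(f - c) ≡ 0`: the case in which `f` admits a wing `W_{f,c}`. -/
structure AdmitsWing (D : Set ℂ) (f : Octonion → Octonion) (c : Octonion) : Prop where
  regular : SliceRegular D f
  nonconstant : ¬ ∃ k, ∀ x ∈ circ D, f x = k
  mem_range : ∃ x ∈ circ D, f x = c
  normal_eq_zero : ∀ x ∈ circ D, normalFn D (fun y => f y - c) x = 0

/-- `f = c + Δ_yⁿ h` on `Ω_D`, with `n > 0` and `h` slice regular on `Ω_D` and not identically zero
on the sphere of `y = φ_J z`. -/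
def IsWingFactor (D : Set ℂ) (f : Octonion → Octonion) (c : Octonion) (z : ℂ) (J : Octonion)
    (n : ℕ) (h : Octonion → Octonion) : Prop :=
  0 < n ∧ SliceRegular D h ∧ (∀ x ∈ circ D, f x = c + npow (Delta (phi J z) x) n * h x) ∧
    ∃ x ∈ sphere z, h x ≠ 0

open Classical in
/-- The map `ω`, constructed with the help of the imaginary unit `I`; `z = α + iβ`. -/
noncomputable def wingMap (D : Set ℂ) (f : Octonion → Octonion) (c I : Octonion) (z : ℂ) :
    Octonion :=
  if sphDeriv f (phi I z) ≠ 0 then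
    z.re • (1 : Octonion) + (c - sphValue f (phi I z)) * (sphDeriv f (phi I z))⁻¹
  else
    let p : ℕ × (Octonion → Octonion) := Classical.epsilon fun p => IsWingFactor D f c z I p.1 p.2
    z.re • (1 : Octonion) - sphValue p.2 (phi I z) * (sphDeriv p.2 (phi I z))⁻¹

/-- The wing `W_{f,c} = ω(D⁺)`. -/
def wing (D : Set ℂ) (f : Octonion → Octonion) (c I : Octonion) : Set Octonion :=
  wingMap D f c I '' upper D

/-- The values `a, b` attached to `x = φ_J z`: they are `f'_c(x), f'_s(x)` if `x ∉ D_f`, and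
`h'_c(x), h'_s(x)` if `x ∈ D_f`, where `f = c + Δ_xⁿ h`. -/
def IsWingData (D : Set ℂ) (f : Octonion → Octonion) (c : Octonion) (z : ℂ) (J a b : Octonion) :
    Prop :=
  (phi J z ∉ degSet D f ∧ a = sliceDeriv D f (phi J z) ∧ b = sphDeriv f (phi J z)) ∨
  (phi J z ∈ degSet D f ∧ ∃ n h, IsWingFactor D f c z J n h ∧
    a = sliceDeriv D h (phi J z) ∧ b = sphDeriv h (phi J z))

/-- `𝒥_x = R_{b⁻¹} ∘ L_J ∘ R_b` at the point `x = α + β J` with `β = |im x| > 0`. -/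
noncomputable def wingStructure (D : Set ℂ) (f : Octonion → Octonion) (c x v : Octonion) :
    Octonion :=
  let J : Octonion := ‖x.im‖⁻¹ • x.im
  let p : Octonion × Octonion :=
    Classical.epsilon fun p => IsWingData D f c ⟨x.re, ‖x.im‖⟩ J p.1 p.2
  (J * (v * p.2)) * p.2⁻¹

/-! ### Submanifolds of `𝕆` -/

/-- The tangent space at `x` to an embedded submanifold `S` of `𝕆`: the velocities at `x` of the
smooth curves in `S` through `x`. -/
def tangentAt (S : Set Octonion) (x : Octonion) : Set Octonion :=
  {v | ∃ γ : ℝ → Octonion, γ 0 = x ∧ ContDiffAt ℝ (⊤ : ℕ∞) γ 0 ∧ deriv γ 0 = v ∧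
    ∀ᶠ t in nhds 0, γ t ∈ S}

/-- The submanifolds `S`, `T` are transverse at `x`: their tangent spaces at `x` span `𝕆`. -/
def TransverseAt (S T : Set Octonion) (x : Octonion) : Prop :=
  ∀ v, ∃ s ∈ tangentAt S x, ∃ t ∈ tangentAt T x, v = s + t

/-- `g` is a real analytic embedding of the open set `U` into `𝕆`: a real analytic immersion that is
a homeomorphism onto its image. -/
def IsAnalyticEmbedding (U : Set ℂ) (g : ℂ → Octonion) : Prop :=
  AnalyticOnNhd ℝ g U ∧ (∀ z ∈ U, Function.Injective (fderiv ℝ g z)) ∧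
    Topology.IsEmbedding (U.domRestrict g)

/-- The `𝒥`-holomorphic charts of a surface `W` in `𝕆` with an almost-complex structure `𝒥`: those
whose inverse is a smooth immersion `ψ` into `𝕆` with `dψ (i v) = 𝒥 (dψ v)`. -/
def complexCharts (W : Set Octonion) (𝒥 : Octonion → Octonion → Octonion) :
    Set (OpenPartialHomeomorph W ℂ) :=
  {e | ContDiffOn ℝ (⊤ : ℕ∞) (fun z => (e.symm z : Octonion)) e.target ∧
    ∀ z ∈ e.target, Function.Injective (fderiv ℝ (fun z => (e.symm z : Octonion)) z) ∧
      ∀ v : ℂ, fderiv ℝ (fun z => (e.symm z : Octonion)) z (Complex.I * v) =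
        𝒥 (e.symm z : Octonion) (fderiv ℝ (fun z => (e.symm z : Octonion)) z v)}

/-- `(W, 𝒥)` is a Riemann surface, with the `𝒥`-holomorphic charts as its atlas, and `g` is a
biholomorphism from `U` to it. The smoothness exponent `⊤` over `ℂ` means complex analytic. -/
def IsBiholomorphism (U : TopologicalSpace.Opens ℂ) (W : Set Octonion)
    (𝒥 : Octonion → Octonion → Octonion) (g : ℂ → Octonion) : Prop :=
  ∃ cs : ChartedSpace ℂ W, cs.atlas = complexCharts W 𝒥 ∧
    IsManifold (modelWithCornersSelf ℂ ℂ) (⊤ : WithTop ℕ∞) W ∧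
    ∃ Φ : Diffeomorph (modelWithCornersSelf ℂ ℂ) (modelWithCornersSelf ℂ ℂ) U W (⊤ : WithTop ℕ∞),
      ∀ z : U, (Φ z : Octonion) = g z

end Slice

/-! Let `G` be the stem function of `f - c`. The hypothesis `N(f - c) ≡ 0` says that `G` takes
values in the null cone of the complex quadratic form `normC`. A nonzero null vector `w = w₁ + ι w₂`
has orthogonal components of equal norm, so `J = -w₁ w₂⁻¹` is an imaginary unit, and it is the only
one with `w₁ + J w₂ = 0` (`unitRoot_mem`, `eq_unitRoot`). Hence on each sphere where `G(z) ≠ 0` the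
function `f` takes the value `c` at exactly one point, and that point is `ω(z)`.

The unit `J` does not change when `w` is multiplied by a nonzero complex scalar (`unitRoot_smulC`).
So zeros of `G` do no harm: write `G = ((y - z)(y - z̄))ⁿ H` with `H(z) ≠ 0`, which is possible
because `G` is holomorphic and not identically zero on the connected `D⁺`. Then `ω(y) = φ_{J(y)}(y)`
near `z`, with `J(y)` the root of `H(y)` (`wingMap_eventuallyEq`). Since `H` is locally unique, this
gives well-definedness, and it gives analyticity.

Differentiating `H₁ + J(y) H₂ = 0` yields `dω(v) b = φ_J(v) (b - a)` (`fderiv_wingMap_mul`). As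
`φ_J(iv) = J φ_J(v)`, this contains both the formula for `dω` and `dω ∘ i = 𝒥 ∘ dω`.
Non-associativity is harmless because only left multiplications by one slice `ℂ_J` and right
multiplication by one octonion occur, where alternativity suffices.

The rest follows from the left inverse `proj` of `ω`, sending `α + βJ` to `α + iβ`: embedding,
intersection with spheres, tangent spaces, transversality and the global chart. -/

namespace Octonion

/-! ### Octonion algebra: conjugation, norm, alternativity, imaginary units. -/

instance : FiniteDimensional ℝ Octonion :=
  inferInstanceAs (FiniteDimensional ℝ (WithLp 2 (Quaternion ℝ × Quaternion ℝ)))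

@[simp] theorem fst_neg (x : Octonion) : (-x).fst = -x.fst := rfl
@[simp] theorem snd_neg (x : Octonion) : (-x).snd = -x.snd := rfl
@[simp] theorem fst_sub (x y : Octonion) : (x - y).fst = x.fst - y.fst := rfl
@[simp] theorem snd_sub (x y : Octonion) : (x - y).snd = x.snd - y.snd := rfl
@[simp] theorem fst_smul (r : ℝ) (x : Octonion) : (r • x).fst = r • x.fst := rfl
@[simp] theorem snd_smul (r : ℝ) (x : Octonion) : (r • x).snd = r • x.snd := rfl
@[simp] theorem fst_star (x : Octonion) : (star x).fst = star x.fst := rfl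
@[simp] theorem snd_star (x : Octonion) : (star x).snd = -x.snd := rfl

instance : IsScalarTower ℝ Octonion Octonion :=
  ⟨fun r x y => by
    change (r • x) * y = r • (x * y)
    ext1 <;> simp [smul_sub, smul_add]⟩

instance : SMulCommClass ℝ Octonion Octonion :=
  ⟨fun r x y => by
    change r • (x * y) = x * (r • y)
    ext1 <;> simp [smul_sub, smul_add]⟩

theorem inner_eq (x y : Octonion) :
    inner ℝ x y = (inner ℝ x.fst y.fst : ℝ) + inner ℝ x.snd y.snd :=
  WithLp.prod_inner_apply x y

theorem norm_sq_eq (x : Octonion) :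
    ‖x‖ ^ 2 = x.fst.re ^ 2 + x.fst.imI ^ 2 + x.fst.imJ ^ 2 + x.fst.imK ^ 2 +
      (x.snd.re ^ 2 + x.snd.imI ^ 2 + x.snd.imJ ^ 2 + x.snd.imK ^ 2) := by
  rw [← real_inner_self_eq_norm_sq, inner_eq, Quaternion.inner_def, Quaternion.inner_def]
  simp
  ring

theorem inner_eq_coord (x y : Octonion) :
    inner ℝ x y = x.fst.re * y.fst.re + x.fst.imI * y.fst.imI + x.fst.imJ * y.fst.imJ +
      x.fst.imK * y.fst.imK + (x.snd.re * y.snd.re + x.snd.imI * y.snd.imI +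
      x.snd.imJ * y.snd.imJ + x.snd.imK * y.snd.imK) := by
  rw [inner_eq, Quaternion.inner_def, Quaternion.inner_def]
  simp

theorem star_add' (x y : Octonion) : star (x + y) = star x + star y := by
  ext1 <;> simp [add_comm]

theorem star_smul' (r : ℝ) (x : Octonion) : star (r • x) = r • star x := by
  ext1 <;> simp

theorem star_star' (x : Octonion) : star (star x) = x := by ext1 <;> simp

theorem star_one' : star (1 : Octonion) = 1 := by ext1 <;> simp

theorem norm_star (x : Octonion) : ‖star x‖ = ‖x‖ := by
  rw [← sq_eq_sq₀ (norm_nonneg _) (norm_nonneg _), norm_sq_eq, norm_sq_eq]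
  simp

theorem mul_star_self (x : Octonion) : x * star x = (‖x‖ ^ 2) • (1 : Octonion) := by
  rw [norm_sq_eq]
  ext <;> simp only [fst_mul, snd_mul, fst_smul, snd_smul, fst_one, snd_one] <;>
    simp [Quaternion.re_one, Quaternion.imI_one, Quaternion.imJ_one, Quaternion.imK_one] <;> ring

theorem mul_star_add (x y : Octonion) :
    x * star y + y * star x = (2 * inner ℝ x y) • (1 : Octonion) := by
  rw [inner_eq_coord]
  ext <;> simp only [fst_mul, snd_mul, fst_add, snd_add, fst_smul, snd_smul, fst_one, snd_one] <;>
    simp [Quaternion.re_one, Quaternion.imI_one, Quaternion.imJ_one, Quaternion.imK_one] <;> ring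

theorem re_mul_star (x y : Octonion) : (x * star y).re = inner ℝ x y := by
  rw [inner_eq_coord, re]
  simp
  ring

/-- Degen's eight-square identity, checked in coordinates. -/
theorem norm_mul (x y : Octonion) : ‖x * y‖ = ‖x‖ * ‖y‖ := by
  rw [← sq_eq_sq₀ (norm_nonneg _) (by positivity), mul_pow, norm_sq_eq, norm_sq_eq, norm_sq_eq]
  simp
  ring

theorem norm_one' : ‖(1 : Octonion)‖ = 1 := by
  rw [← sq_eq_sq₀ (norm_nonneg _) zero_le_one, norm_sq_eq]
  simp [Quaternion.re_zero, Quaternion.imI_zero, Quaternion.imJ_zero,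
    Quaternion.imK_zero, Quaternion.re_one, Quaternion.imI_one, Quaternion.imJ_one, Quaternion.imK_one]

/-- Right alternativity. With `star_mul_mul` it replaces associativity wherever an octonion is
cancelled. -/
theorem mul_mul_star (x y : Octonion) : (x * y) * star y = (‖y‖ ^ 2) • x := by
  rw [norm_sq_eq]
  ext <;> simp <;> ring

theorem mul_star_mul (x y : Octonion) : (x * star y) * y = (‖y‖ ^ 2) • x := by
  have := mul_mul_star x (star y)
  rwa [star_star', norm_star] at this

theorem star_mul_mul (x y : Octonion) : star x * (x * y) = (‖x‖ ^ 2) • y := by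
  rw [norm_sq_eq]
  ext <;> simp <;> ring

theorem inv_def (x : Octonion) : x⁻¹ = (‖x‖ ^ 2)⁻¹ • star x := rfl

theorem mul_mul_inv (x : Octonion) {y : Octonion} (hy : y ≠ 0) : (x * y) * y⁻¹ = x := by
  rw [inv_def, mul_smul_comm, mul_mul_star, smul_smul, inv_mul_cancel₀, one_smul]
  exact pow_ne_zero 2 (norm_ne_zero_iff.2 hy)

theorem mul_inv_mul (x : Octonion) {y : Octonion} (hy : y ≠ 0) : (x * y⁻¹) * y = x := by
  rw [inv_def, mul_smul_comm, smul_mul_assoc, mul_star_mul, smul_smul, inv_mul_cancel₀, one_smul]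
  exact pow_ne_zero 2 (norm_ne_zero_iff.2 hy)

theorem smul_inv' (r : ℝ) (x : Octonion) : (r • x)⁻¹ = r⁻¹ • x⁻¹ := by
  rcases eq_or_ne r 0 with rfl | hr
  · rw [inv_zero, zero_smul, zero_smul, inv_def, norm_zero]
    simp
  · rw [inv_def, inv_def, star_smul', norm_smul, smul_smul, smul_smul, mul_pow, Real.norm_eq_abs,
      sq_abs]
    congr 1
    field_simp

theorem mul_eq_zero' {x y : Octonion} : x * y = 0 ↔ x = 0 ∨ y = 0 := by
  rw [← norm_eq_zero, norm_mul, mul_eq_zero, norm_eq_zero, norm_eq_zero]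

theorem mul_right_cancel' {x y z : Octonion} (hz : z ≠ 0) (h : x * z = y * z) : x = y := by
  rw [← mul_mul_inv x hz, h, mul_mul_inv y hz]

theorem norm_inv' (x : Octonion) : ‖x⁻¹‖ = ‖x‖⁻¹ := by
  rcases eq_or_ne x 0 with rfl | hx
  · simp [inv_def]
  · have := norm_ne_zero_iff.2 hx
    rw [inv_def, norm_smul, norm_star, norm_inv, norm_pow, norm_norm]
    field_simp

theorem re_mul_inv (x y : Octonion) : (x * y⁻¹).re = (‖y‖ ^ 2)⁻¹ * inner ℝ x y := by
  rw [inv_def, mul_smul_comm, ← re_mul_star]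
  simp [re, mul_add]

/-- The real part, as a continuous linear functional. -/
noncomputable def reL : Octonion →L[ℝ] ℝ :=
  LinearMap.toContinuousLinearMap
    { toFun := re
      map_add' := fun _ _ => rfl
      map_smul' := fun _ _ => rfl }

@[simp] theorem reL_apply (x : Octonion) : reL x = x.re := rfl

@[simp] theorem re_add (x y : Octonion) : (x + y).re = x.re + y.re := rfl
@[simp] theorem re_sub (x y : Octonion) : (x - y).re = x.re - y.re := rfl
@[simp] theorem re_neg (x : Octonion) : (-x).re = -x.re := rfl
@[simp] theorem re_smul (r : ℝ) (x : Octonion) : (r • x).re = r * x.re := rfl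
@[simp] theorem re_one : (1 : Octonion).re = 1 := rfl
@[simp] theorem re_zero : (0 : Octonion).re = 0 := rfl

theorem inner_one (x : Octonion) : inner ℝ x (1 : Octonion) = x.re := by
  rw [← re_mul_star, star_one', mul_one]

/-- The imaginary part, as a continuous linear map. -/
noncomputable def imL : Octonion →L[ℝ] Octonion :=
  ContinuousLinearMap.id ℝ Octonion - reL.smulRight 1

@[simp] theorem imL_apply (x : Octonion) : imL x = x.im := rfl

/-- Multiplication, as a continuous bilinear map. -/
noncomputable def mulL : Octonion →L[ℝ] Octonion →L[ℝ] Octonion :=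
  (LinearMap.mul ℝ Octonion).mkContinuous₂ 1 fun x y => by
    rw [LinearMap.mul_apply', norm_mul, one_mul]

@[simp] theorem mulL_apply (x y : Octonion) : mulL x y = x * y := rfl

/-- The conjugation, as a continuous linear map. -/
noncomputable def starL : Octonion →L[ℝ] Octonion :=
  LinearMap.toContinuousLinearMap
    { toFun := star
      map_add' := star_add'
      map_smul' := star_smul' }

@[simp] theorem starL_apply (x : Octonion) : starL x = star x := rfl

theorem add_star (x : Octonion) : x + star x = (2 * x.re) • (1 : Octonion) := by
  ext <;> simp [re, Quaternion.re_one, Quaternion.imI_one, Quaternion.imJ_one, Quaternion.imK_one,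
    two_mul]

theorem mem_imUnits {J : Octonion} : J ∈ imUnits ↔ J.re = 0 ∧ ‖J‖ = 1 := by
  have h1 : (1 : Octonion) ≠ 0 := by
    rw [← norm_ne_zero_iff, norm_one']; exact one_ne_zero
  have e1 : J + star J = 0 ↔ J.re = 0 := by
    rw [add_star, smul_eq_zero]; simp [h1]
  have e2 : J * star J = 1 ↔ ‖J‖ = 1 := by
    rw [mul_star_self]
    constructor
    · intro h
      have h' := congrArg re h
      simp only [re_smul, re_one, mul_one] at h'
      exact (pow_eq_one_iff_of_nonneg (norm_nonneg _) two_ne_zero).1 h'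
    · intro h; simp [h]
  rw [imUnits, Set.mem_ofPred_eq, e1, e2]

theorem re_of_mem_imUnits {J : Octonion} (hJ : J ∈ imUnits) : J.re = 0 := (mem_imUnits.1 hJ).1

theorem norm_of_mem_imUnits {J : Octonion} (hJ : J ∈ imUnits) : ‖J‖ = 1 := (mem_imUnits.1 hJ).2

theorem ne_zero_of_mem_imUnits {J : Octonion} (hJ : J ∈ imUnits) : J ≠ 0 := by
  rw [← norm_ne_zero_iff, norm_of_mem_imUnits hJ]; exact one_ne_zero

theorem neg_mem_imUnits {J : Octonion} (hJ : J ∈ imUnits) : -J ∈ imUnits := by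
  rw [mem_imUnits] at hJ ⊢
  simpa using hJ

theorem star_of_mem_imUnits {J : Octonion} (hJ : J ∈ imUnits) : star J = -J := by
  have := add_star J
  rw [re_of_mem_imUnits hJ, mul_zero, zero_smul] at this
  exact (neg_eq_of_add_eq_zero_right this).symm

/-- Left alternativity with `J^c = -J`: left multiplication by `J` is a complex structure on `𝕆`. -/
theorem imUnits_mul_mul {J : Octonion} (hJ : J ∈ imUnits) (x : Octonion) :
    J * (J * x) = -x := by
  have := star_mul_mul J x
  rw [star_of_mem_imUnits hJ, norm_of_mem_imUnits hJ, one_pow, one_smul, neg_mul] at this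
  exact neg_eq_iff_eq_neg.1 this

theorem imUnits_mul_self {J : Octonion} (hJ : J ∈ imUnits) : J * J = -1 := by
  simpa using imUnits_mul_mul hJ 1

end Octonion

namespace Slice

open Octonion

/-! ### The slices `ℂ_J` -/

@[simp] theorem re_phi {J : Octonion} (hJ : J ∈ imUnits) (z : ℂ) : (phi J z).re = z.re := by
  simp [phi, re_of_mem_imUnits hJ]

@[simp] theorem im_phi {J : Octonion} (hJ : J ∈ imUnits) (z : ℂ) : (phi J z).im = z.im • J := by
  rw [im, re_phi hJ, phi]
  abel

theorem norm_im_phi {J : Octonion} (hJ : J ∈ imUnits) (z : ℂ) : ‖(phi J z).im‖ = |z.im| := by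
  rw [im_phi hJ, norm_smul, norm_of_mem_imUnits hJ, mul_one, Real.norm_eq_abs]

theorem star_phi {J : Octonion} (hJ : J ∈ imUnits) (z : ℂ) : star (phi J z) = phi (-J) z := by
  rw [phi, star_add', star_smul', star_smul', star_one', star_of_mem_imUnits hJ, phi]

theorem phi_neg_conj (J : Octonion) (z : ℂ) : phi (-J) ((starRingEnd ℂ) z) = phi J z := by
  simp [phi]

theorem phi_mul {J : Octonion} (hJ : J ∈ imUnits) (z w : ℂ) :
    phi J (z * w) = phi J z * phi J w := by
  simp only [phi, Complex.mul_re, Complex.mul_im, mul_add, add_mul, smul_mul_assoc, mul_smul_comm,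
    one_mul, mul_one, imUnits_mul_self hJ]
  module

theorem npow_phi {J : Octonion} (hJ : J ∈ imUnits) (z : ℂ) (n : ℕ) :
    npow (phi J z) n = phi J (z ^ n) := by
  induction n with
  | zero => simp [npow, phi]
  | succ n ih => rw [npow, ih, pow_succ, phi_mul hJ]

/-- The complex polynomial `(z - w) (z - w̄)`. -/
noncomputable def quad (w z : ℂ) : ℂ := (z - w) * (z - (starRingEnd ℂ) w)

theorem quad_conj (w z : ℂ) :
    quad w ((starRingEnd ℂ) z) = (starRingEnd ℂ) (quad w z) := by
  simp only [quad, map_mul, map_sub, Complex.conj_conj]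
  ring

theorem quad_self (w : ℂ) : quad w w = 0 := by simp [quad]

theorem quad_ne_zero {w z : ℂ} (hw : 0 < w.im) (hz : 0 < z.im) (h : z ≠ w) : quad w z ≠ 0 := by
  refine mul_ne_zero (sub_ne_zero.2 h) (sub_ne_zero.2 fun e => ?_)
  have := congrArg Complex.im e
  rw [Complex.conj_im] at this
  linarith

/-- `Δ_y` involves only the trace and norm of `y`, so it sees the sphere of `y` but not `I`, and on
every slice it is the same real quadratic polynomial. -/
theorem Delta_phi {I J : Octonion} (hI : I ∈ imUnits) (hJ : J ∈ imUnits) (w z : ℂ) :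
    Delta (phi I w) (phi J z) = phi J (quad w z) := by
  have hn : ‖phi I w‖ ^ 2 = w.re ^ 2 + w.im ^ 2 := by
    rw [phi, norm_add_sq_real, norm_smul, norm_smul, inner_smul_left, inner_smul_right,
      real_inner_comm, inner_one, re_of_mem_imUnits hI, norm_of_mem_imUnits hI, norm_one',
      Real.norm_eq_abs, Real.norm_eq_abs, mul_one, mul_one, sq_abs, sq_abs]
    simp
  rw [Delta, add_star, mul_star_self, hn, re_phi hI, ← phi_mul hJ, mul_smul_comm, mul_one]
  simp only [phi, quad, Complex.mul_re, Complex.mul_im, Complex.sub_re, Complex.sub_im,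
    Complex.conj_re, Complex.conj_im]
  module

theorem phi_injective {z w : ℂ} (hz : 0 < z.im) (hw : 0 < w.im) {J K : Octonion}
    (hJ : J ∈ imUnits) (hK : K ∈ imUnits) (h : phi J z = phi K w) : z = w ∧ J = K := by
  have h1 : z.re = w.re := by rw [← re_phi hJ, h, re_phi hK]
  have h2 : z.im = w.im := by
    rw [← abs_of_pos hz, ← norm_im_phi hJ, h, norm_im_phi hK, abs_of_pos hw]
  refine ⟨Complex.ext h1 h2, ?_⟩
  have h3 := congrArg im h
  rw [im_phi hJ, im_phi hK, ← h2] at h3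
  exact smul_right_injective _ hz.ne' h3

/-! ### The complexification -/

/-- Multiplication by a complex scalar. -/
noncomputable def smulC (g : ℂ) (w : OctonionC) : OctonionC := g.re • w + g.im • iotaC w

theorem phiC_add (J : Octonion) (w w' : OctonionC) : phiC J (w + w') = phiC J w + phiC J w' := by
  simp only [phiC, Prod.fst_add, Prod.snd_add, mul_add]
  abel

theorem phiC_smul (J : Octonion) (r : ℝ) (w : OctonionC) : phiC J (r • w) = r • phiC J w := by
  simp only [phiC, Prod.smul_fst, Prod.smul_snd, mul_smul_comm, smul_add]

theorem phiC_iotaC {J : Octonion} (hJ : J ∈ imUnits) (w : OctonionC) :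
    phiC J (iotaC w) = J * phiC J w := by
  simp only [phiC, iotaC, mul_add, imUnits_mul_mul hJ]
  abel

/-- `φ_J` is complex linear once `𝕆` carries the complex structure given by left multiplication by
`J`. -/
theorem phiC_smulC {J : Octonion} (hJ : J ∈ imUnits) (g : ℂ) (w : OctonionC) :
    phiC J (smulC g w) = phi J g * phiC J w := by
  rw [smulC, phiC_add, phiC_smul, phiC_smul, phiC_iotaC hJ, phi, add_mul, smul_mul_assoc,
    smul_mul_assoc, one_mul]

/-- The sum of the values for `J` and `-J` recovers the first component; either value then gives the
second. This is why stem functions are unique. -/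
theorem eq_of_phiC_eq {J : Octonion} (hJ : J ∈ imUnits) {w w' : OctonionC}
    (h : phiC J w = phiC J w') (h' : phiC (-J) w = phiC (-J) w') : w = w' := by
  have h2 : w.1 = w'.1 := by
    have : (2 : ℝ) • w.1 = (2 : ℝ) • w'.1 := by
      have e := congrArg₂ (· + ·) h h'
      simp only [phiC, neg_mul] at e
      calc (2 : ℝ) • w.1 = w.1 + J * w.2 + (w.1 + -(J * w.2)) := by module
        _ = _ := e
        _ = _ := by module
    exact smul_right_injective _ two_ne_zero this
  refine Prod.ext h2 ?_
  rw [phiC, phiC, h2, add_right_inj] at h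
  rw [← neg_inj, ← imUnits_mul_mul hJ, ← imUnits_mul_mul hJ, h]

/-- The complex coordinates on the complexification. -/
noncomputable def coordC :
    OctonionC ≃L[ℝ] (Fin (Module.finrank ℝ Octonion) → ℂ) :=
  LinearEquiv.toContinuousLinearEquiv
    { toFun := fun w k => ⟨(Module.finBasis ℝ Octonion).equivFun w.1 k,
        (Module.finBasis ℝ Octonion).equivFun w.2 k⟩
      invFun := fun v => ((Module.finBasis ℝ Octonion).equivFun.symm fun k => (v k).re,
        (Module.finBasis ℝ Octonion).equivFun.symm fun k => (v k).im)
      map_add' := fun w w' => by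
        ext k
        apply Complex.ext <;> simp
      map_smul' := fun r w => by
        ext k
        apply Complex.ext <;> simp
      left_inv := fun w => by
        apply Prod.ext <;> exact LinearEquiv.symm_apply_apply _ _
      right_inv := fun v => by
        ext k
        apply Complex.ext <;> simp [-Module.Basis.equivFun_apply] }

theorem coordC_iotaC (w : OctonionC) : coordC (iotaC w) = Complex.I • coordC w := by
  ext k
  apply Complex.ext <;> simp [coordC, iotaC]

theorem coordC_smulC (g : ℂ) (w : OctonionC) : coordC (smulC g w) = g • coordC w := by
  rw [smulC, map_add, map_smul, map_smul, coordC_iotaC]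
  ext k
  apply Complex.ext <;> simp [sub_eq_add_neg]

theorem coordC_barC (w : OctonionC) :
    coordC (barC w) = fun k => (starRingEnd ℂ) (coordC w k) := by
  ext k
  apply Complex.ext <;> simp [coordC, barC]

theorem smulC_mul (g g' : ℂ) (w : OctonionC) : smulC (g * g') w = smulC g (smulC g' w) := by
  apply coordC.injective
  rw [coordC_smulC, coordC_smulC, coordC_smulC, mul_smul]

theorem smulC_one (w : OctonionC) : smulC 1 w = w := by
  apply coordC.injective
  rw [coordC_smulC, one_smul]

theorem smulC_right_injective {g : ℂ} (hg : g ≠ 0) : Function.Injective (smulC g) := by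
  intro w w' h
  have := congrArg (smulC g⁻¹) h
  rwa [← smulC_mul, ← smulC_mul, inv_mul_cancel₀ hg, smulC_one, smulC_one] at this

theorem smulC_zero (g : ℂ) : smulC g 0 = 0 := by
  apply coordC.injective
  rw [coordC_smulC, map_zero, smul_zero]

theorem smulC_ne_zero {g : ℂ} (hg : g ≠ 0) {w : OctonionC} (hw : w ≠ 0) : smulC g w ≠ 0 :=
  fun h => hw (smulC_right_injective hg (h.trans (smulC_zero g).symm))

theorem barC_smulC (g : ℂ) (w : OctonionC) :
    barC (smulC g w) = smulC ((starRingEnd ℂ) g) (barC w) := by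
  apply coordC.injective
  rw [coordC_barC, coordC_smulC, coordC_smulC, coordC_barC]
  ext k
  simp

theorem iotaC_iotaC (w : OctonionC) : iotaC (iotaC w) = -w := by
  apply Prod.ext <;> simp [iotaC]

/-! ### Null vectors of the complexification -/

/-- The complex quadratic form `w ↦ w w^c` on the complexification. -/
noncomputable def normC (w : OctonionC) : ℂ := ⟨‖w.1‖ ^ 2 - ‖w.2‖ ^ 2, 2 * inner ℝ w.1 w.2⟩

theorem mulC_starC (w : OctonionC) :
    mulC w (starC w) = ((normC w).re • (1 : Octonion), (normC w).im • (1 : Octonion)) := by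
  apply Prod.ext
  · simp only [mulC, starC, mul_star_self, normC, sub_smul]
  · simp only [mulC, starC, mul_star_add, normC]

theorem normC_smulC (g : ℂ) (w : OctonionC) : normC (smulC g w) = g ^ 2 * normC w := by
  have h1 : (smulC g w).1 = g.re • w.1 - g.im • w.2 := by simp [smulC, iotaC, sub_eq_add_neg]
  have h2 : (smulC g w).2 = g.re • w.2 + g.im • w.1 := by simp [smulC, iotaC]
  have hc := real_inner_comm w.1 w.2
  rw [sq g]
  apply Complex.ext
  · simp only [normC, h1, h2, norm_sub_sq_real, norm_add_sq_real, inner_smul_left,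
      inner_smul_right, norm_smul, mul_pow, Complex.mul_re, Complex.mul_im, hc, conj_trivial,
      Real.norm_eq_abs, sq_abs]
    ring
  · simp only [normC, h1, h2, inner_sub_left, inner_add_right, inner_smul_left, inner_smul_right,
      Complex.mul_re, Complex.mul_im, hc, conj_trivial, real_inner_self_eq_norm_sq]
    ring

theorem continuous_normC : Continuous normC := by
  have : normC = fun w => ((‖w.1‖ ^ 2 - ‖w.2‖ ^ 2 : ℝ) : ℂ) +
      ((2 * inner ℝ w.1 w.2 : ℝ) : ℂ) * Complex.I := by
    ext w
    apply Complex.ext <;> simp [normC, -Complex.ofReal_pow]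
  rw [this]
  fun_prop

/-- The imaginary unit `J` with `φ_J w = 0`, for a nonzero null vector `w`. -/
noncomputable def unitRoot (w : OctonionC) : Octonion := -(w.1 * w.2⁻¹)

theorem snd_ne_zero_of_normC {w : OctonionC} (h : normC w = 0) (hw : w ≠ 0) : w.2 ≠ 0 := by
  intro h2
  have h1 := congrArg Complex.re h
  simp only [normC, h2, norm_zero, Complex.zero_re] at h1
  have h1' : w.1 = 0 := by
    rw [← norm_eq_zero]
    simpa using h1
  exact hw (Prod.ext h1' h2)

/-- The real part of `normC w = 0` makes the two norms equal, so the quotient has norm `1`; the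
imaginary part makes the components orthogonal, so the quotient has real part `0`. -/
theorem unitRoot_mem {w : OctonionC} (h : normC w = 0) (hw : w ≠ 0) : unitRoot w ∈ imUnits := by
  have h2 := norm_ne_zero_iff.2 (snd_ne_zero_of_normC h hw)
  have hre := congrArg Complex.re h
  have him := congrArg Complex.im h
  simp only [normC, Complex.zero_re, Complex.zero_im] at hre him
  rw [mem_imUnits, unitRoot, re_neg, norm_neg, re_mul_inv, norm_mul, norm_inv']
  constructor
  · have : inner ℝ w.1 w.2 = 0 := by linarith
    rw [this, mul_zero, neg_zero]
  · have : ‖w.1‖ = ‖w.2‖ := by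
      rw [← sq_eq_sq₀ (norm_nonneg _) (norm_nonneg _)]
      linarith
    rw [this, mul_inv_cancel₀ h2]

theorem phiC_unitRoot {w : OctonionC} (h : w.2 ≠ 0) : phiC (unitRoot w) w = 0 := by
  rw [phiC, unitRoot, neg_mul, mul_inv_mul _ h, add_neg_cancel]

theorem eq_unitRoot {w : OctonionC} (h : w.2 ≠ 0) {J : Octonion} (hJ : phiC J w = 0) :
    J = unitRoot w := by
  apply mul_right_cancel' h
  have := phiC_unitRoot h
  rw [phiC] at hJ this
  exact add_left_cancel (hJ.trans this.symm)

/-- By complex linearity of `φ_J`, a unit `J` that kills `w` also kills its multiples. This lets `ω`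
extend across the zeros of `G`. -/
theorem unitRoot_smulC {g : ℂ} (hg : g ≠ 0) {w : OctonionC} (h : normC w = 0) (hw : w ≠ 0) :
    unitRoot (smulC g w) = unitRoot w := by
  have h' : normC (smulC g w) = 0 := by rw [normC_smulC, h, mul_zero]
  refine (eq_unitRoot (snd_ne_zero_of_normC h' (smulC_ne_zero hg hw)) ?_).symm
  rw [phiC_smulC (unitRoot_mem h hw), phiC_unitRoot (snd_ne_zero_of_normC h hw), mul_zero]

/-! ### Slice functions and their stem functions -/

section Stem

variable {D : Set ℂ} {F : ℂ → OctonionC} {f : Octonion → Octonion} {z : ℂ} {J : Octonion}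

theorem phi_mem_circ (hz : z ∈ D) (hJ : J ∈ imUnits) : phi J z ∈ circ D := ⟨z, hz, J, hJ, rfl⟩

theorem exists_upper_of_mem_circ (hD : IsProductBase D) {x : Octonion} (hx : x ∈ circ D) :
    ∃ z ∈ upper D, ∃ J ∈ imUnits, x = phi J z := by
  obtain ⟨z, hz, J, hJ, rfl⟩ := hx
  rcases lt_or_gt_of_ne (hD.im_ne_zero z hz) with h | h
  · exact ⟨(starRingEnd ℂ) z, ⟨hD.conj_mem z hz, by simpa using h⟩, -J, neg_mem_imUnits hJ,
      (phi_neg_conj J z).symm⟩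
  · exact ⟨z, ⟨hz, h⟩, J, hJ, rfl⟩

theorem Induces.eqOn {F' : ℂ → OctonionC} (h : Induces D F f) (h' : Induces D F' f)
    (hJ : J ∈ imUnits) : Set.EqOn F F' D := fun z hz =>
  eq_of_phiC_eq hJ (by rw [← h z hz J hJ, ← h' z hz J hJ])
    (by rw [← h z hz _ (neg_mem_imUnits hJ), ← h' z hz _ (neg_mem_imUnits hJ)])

theorem stemFn_eqOn (hs : IsStem D F) (hi : Induces D F f) (hJ : J ∈ imUnits) :
    Set.EqOn (stemFn D f) F D := by
  have h : IsStem D (stemFn D f) ∧ Induces D (stemFn D f) f :=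
    Classical.epsilon_spec (p := fun F => IsStem D F ∧ Induces D F f) ⟨F, hs, hi⟩
  exact h.2.eqOn hi hJ

/-- `induce` always evaluates `F` in the upper half-plane; the stem symmetry makes this agree with
the value at a point of the lower one. -/
theorem induces_induce (hD : ∀ z ∈ D, z.im ≠ 0) (hs : IsStem D F) : Induces D F (induce F) := by
  intro z hz J hJ
  rw [induce, norm_im_phi hJ, im_phi hJ, re_phi hJ]
  rcases lt_or_gt_of_ne (hD z hz) with h | h
  · have e : (⟨z.re, |z.im|⟩ : ℂ) = (starRingEnd ℂ) z := by
      apply Complex.ext <;> simp [abs_of_neg h]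
    rw [e, hs z hz, abs_of_neg h, smul_smul, inv_neg, neg_mul, inv_mul_cancel₀ h.ne]
    simp [phiC, barC]
  · have e : (⟨z.re, |z.im|⟩ : ℂ) = z := by
      apply Complex.ext <;> simp [abs_of_pos h]
    rw [e, abs_of_pos h, smul_smul, inv_mul_cancel₀ h.ne', one_smul]

theorem induce_phi (hz : 0 < z.im) (hJ : J ∈ imUnits) : induce F (phi J z) = phiC J (F z) := by
  rw [induce, norm_im_phi hJ, im_phi hJ, re_phi hJ, abs_of_pos hz, smul_smul,
    inv_mul_cancel₀ hz.ne', one_smul]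

theorem sphValue_phi (hi : Induces D F f) (hz : z ∈ D) (hJ : J ∈ imUnits) :
    sphValue f (phi J z) = (F z).1 := by
  rw [sphValue, star_phi hJ, hi z hz J hJ, hi z hz _ (neg_mem_imUnits hJ), phiC, phiC, neg_mul]
  module

theorem sphDeriv_phi (hi : Induces D F f) (hz : z ∈ D) (hJ : J ∈ imUnits) :
    sphDeriv f (phi J z) = z.im⁻¹ • (F z).2 := by
  have e : phiC J (F z) - phiC (-J) (F z) = (2 : ℝ) • (J * (F z).2) := by
    rw [phiC, phiC, neg_mul]
    module
  rw [sphDeriv, star_phi hJ, hi z hz J hJ, hi z hz _ (neg_mem_imUnits hJ), im_phi hJ, smul_inv',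
    inv_def, norm_of_mem_imUnits hJ, star_of_mem_imUnits hJ, e, mul_smul_comm, smul_smul,
    smul_mul_assoc, smul_mul_assoc, neg_mul, imUnits_mul_mul hJ]
  norm_num

end Stem

end Slice

namespace Slice

open Octonion Filter Topology

/-! ### Holomorphic stem functions -/

section Holomorphic

variable {D : Set ℂ} {F : ℂ → OctonionC} {z : ℂ}

/-- The stem equation is the Cauchy-Riemann system in the coordinates `coordC`, so the theory of
holomorphic functions (analyticity, identity theorem, removable zeros) becomes available. -/
theorem holomorphicStem_iff (hD : IsOpen D) :
    HolomorphicStem D F ↔ DifferentiableOn ℂ (fun z => coordC (F z)) D := by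
  have key : ∀ z, DifferentiableAt ℝ F z →
      (fderiv ℝ F z 1 + iotaC (fderiv ℝ F z Complex.I) = 0 ↔
        fderiv ℝ (fun z => coordC (F z)) z Complex.I =
          Complex.I • fderiv ℝ (fun z => coordC (F z)) z 1) := by
    intro z hz
    have e : fderiv ℝ (fun z => coordC (F z)) z =
        (coordC : OctonionC →L[ℝ] Fin (Module.finrank ℝ Octonion) → ℂ).comp (fderiv ℝ F z) :=
      (coordC.hasFDerivAt.comp z hz.hasFDerivAt).fderiv
    rw [e]
    simp only [ContinuousLinearMap.comp_apply, ContinuousLinearEquiv.coe_coe]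
    rw [← coordC_iotaC, coordC.injective.eq_iff]
    constructor
    · intro h
      rw [eq_neg_of_add_eq_zero_left h, ← neg_one_smul ℝ (iotaC _)]
      have := iotaC_iotaC (fderiv ℝ F z Complex.I)
      apply Prod.ext <;> simp [iotaC]
    · intro h
      rw [h, iotaC_iotaC, add_neg_cancel]
  constructor
  · rintro ⟨hF, h⟩ z hz
    have hd : DifferentiableAt ℝ F z :=
      (hF.differentiableOn one_ne_zero).differentiableAt (hD.mem_nhds hz)
    refine (differentiableAt_complex_iff_differentiableAt_real.2
      ⟨?_, (key z hd).1 (h z hz)⟩).differentiableWithinAt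
    exact coordC.differentiableAt.comp z hd
  · intro h
    have hc : ContDiffOn ℝ 1 F D := by
      have h1 : ContDiffOn ℝ 1 (fun z => coordC (F z)) D := (h.contDiffOn hD).restrict_scalars ℝ
      have h2 := coordC.symm.contDiff.comp_contDiffOn h1
      exact h2.congr fun z _ => by simp
    refine ⟨hc, fun z hz => (key z ?_).2 ?_⟩
    · exact (hc.differentiableOn one_ne_zero).differentiableAt (hD.mem_nhds hz)
    · exact (differentiableAt_complex_iff_differentiableAt_real.1
        (h.differentiableAt (hD.mem_nhds hz))).2

theorem HolomorphicStem.analyticAt (hF : HolomorphicStem D F) (hD : IsOpen D) (hz : z ∈ D) :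
    AnalyticAt ℂ (fun z => coordC (F z)) z :=
  ((holomorphicStem_iff hD).1 hF).analyticAt (hD.mem_nhds hz)

theorem HolomorphicStem.contDiffAt (hF : HolomorphicStem D F) (hD : IsOpen D) (hz : z ∈ D) :
    ContDiffAt ℝ (⊤ : WithTop ℕ∞) F z := by
  have h1 : ContDiffAt ℝ (⊤ : WithTop ℕ∞) (fun z => coordC (F z)) z :=
    (hF.analyticAt hD hz).contDiffAt.restrict_scalars ℝ
  have h2 := coordC.symm.contDiff.contDiffAt.comp z h1
  exact h2.congr_of_eventuallyEq (Eventually.of_forall fun z => by simp)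

theorem HolomorphicStem.continuousOn (hF : HolomorphicStem D F) : ContinuousOn F D :=
  hF.1.continuousOn

theorem HolomorphicStem.differentiableAt (hF : HolomorphicStem D F) (hD : IsOpen D)
    (hz : z ∈ D) : DifferentiableAt ℝ F z :=
  (hF.1.differentiableOn one_ne_zero).differentiableAt (hD.mem_nhds hz)

theorem HolomorphicStem.fderiv_I (hF : HolomorphicStem D F) (hz : z ∈ D) :
    fderiv ℝ F z Complex.I = iotaC (fderiv ℝ F z 1) := by
  have h := hF.2 z hz
  rw [eq_neg_of_add_eq_zero_left h]
  apply Prod.ext <;> simp [iotaC]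

/-- A holomorphic stem function that vanishes at `w` is divisible by `(z - w) (z - w̄)`. -/
theorem exists_eq_quad_smulC (hD : IsProductBase D) (hs : IsStem D F) (hF : HolomorphicStem D F)
    {w : ℂ} (hw : w ∈ D) (h0 : F w = 0) :
    ∃ H, IsStem D H ∧ HolomorphicStem D H ∧ ∀ z, F z = smulC (quad w z) (H z) := by
  set w' := (starRingEnd ℂ) w with hw'
  have hwD : w' ∈ D := hD.conj_mem w hw
  have hww : w' - w ≠ 0 := by
    intro e
    have := congrArg Complex.im e
    rw [Complex.sub_im, hw', Complex.conj_im, Complex.zero_im] at this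
    exact hD.im_ne_zero w hw (by linarith)
  set G : ℂ → (Fin (Module.finrank ℝ Octonion) → ℂ) := fun z => coordC (F z) with hG
  have hGd := (holomorphicStem_iff hD.isOpen).1 hF
  have hG0 : G w = 0 := by simp [hG, h0]
  have hG0' : G w' = 0 := by
    have : F w' = 0 := by rw [hw', hs w hw, h0]; simp [barC]
    simp [hG, this]
  -- As `D` misses the real line, `w` and `w̄` are distinct zeros, so the two linear factors can be
  -- divided out in turn.
  set K := dslope (dslope G w) w' with hK
  have hKd : DifferentiableOn ℂ K D :=
    (Complex.differentiableOn_dslope (hD.isOpen.mem_nhds hwD)).2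
      ((Complex.differentiableOn_dslope (hD.isOpen.mem_nhds hw)).2 hGd)
  have e1 : ∀ z, (z - w) • dslope G w z = G z := fun z => by
    rw [sub_smul_dslope, hG0, sub_zero]
  have e2 : dslope G w w' = 0 := by
    have := e1 w'
    rw [hG0', smul_eq_zero] at this
    exact this.resolve_left hww
  have e3 : ∀ z, G z = quad w z • K z := fun z => by
    rw [quad, mul_smul, hK, sub_smul_dslope, e2, sub_zero, e1]
  have eF : ∀ z, F z = smulC (quad w z) (coordC.symm (K z)) := fun z => by
    apply coordC.injective
    rw [coordC_smulC, ContinuousLinearEquiv.apply_symm_apply, ← e3]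
  have hH : HolomorphicStem D fun z => coordC.symm (K z) := by
    rw [holomorphicStem_iff hD.isOpen]
    simpa using hKd
  refine ⟨fun z => coordC.symm (K z), ?_, hH, eF⟩
  have hc1 : ContinuousOn (fun z => coordC.symm (K ((starRingEnd ℂ) z))) D :=
    hH.continuousOn.comp Complex.continuous_conj.continuousOn fun z hz => hD.conj_mem z hz
  have hc2 : ContinuousOn (fun z => barC (coordC.symm (K z))) D := by
    have : Continuous barC := by unfold barC; fun_prop
    exact this.comp_continuousOn hH.continuousOn
  have hne : ∀ z ∈ D, quad w z ≠ 0 →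
      coordC.symm (K ((starRingEnd ℂ) z)) = barC (coordC.symm (K z)) := by
    intro z hz hq
    have hq' : quad w ((starRingEnd ℂ) z) ≠ 0 := by
      rw [quad_conj]
      exact (map_ne_zero _).2 hq
    apply smulC_right_injective hq'
    rw [← eF, quad_conj, ← barC_smulC, ← eF, hs z hz]
  -- The symmetry of the quotient is known off the zeros of `quad w`, which are isolated, and
  -- extends by continuity.
  intro z hz
  have hev : ∀ᶠ y in 𝓝[≠] z, quad w y ≠ 0 := by
    have ha : ∀ v : ℂ, ∀ᶠ y in 𝓝[≠] z, y ≠ v := fun v => by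
      rcases eq_or_ne z v with rfl | h
      · exact self_mem_nhdsWithin
      · exact mem_nhdsWithin_of_mem_nhds (isOpen_ne.mem_nhds h)
    filter_upwards [ha w, ha w'] with y h1 h2
    exact mul_ne_zero (sub_ne_zero.2 h1) (sub_ne_zero.2 h2)
  have hDz := hD.isOpen.mem_nhds hz
  have t1 := (hc1.continuousAt hDz).tendsto.mono_left (nhdsWithin_le_nhds (s := {z}ᶜ))
  have t2 := (hc2.continuousAt hDz).tendsto.mono_left (nhdsWithin_le_nhds (s := {z}ᶜ))
  refine tendsto_nhds_unique (t1.congr' ?_) t2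
  filter_upwards [hev, mem_nhdsWithin_of_mem_nhds hDz] with y h1 h2
  exact hne y h2 h1

/-- `F = ((z - w) (z - w̄))ⁿ H` on `D` for a holomorphic stem function `H` with `H(w) ≠ 0`. -/
structure IsStemFactor (D : Set ℂ) (F : ℂ → OctonionC) (w : ℂ) (n : ℕ) (H : ℂ → OctonionC) :
    Prop where
  stem : IsStem D H
  holo : HolomorphicStem D H
  ne_zero : H w ≠ 0
  eq : ∀ z ∈ D, F z = smulC (quad w z ^ n) (H z)

/-- Induction on the vanishing order at `w`: dividing by `(z - w)(z - w̄)` lowers it by exactly one,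
since `z - w̄` does not vanish at `w`. -/
theorem exists_isStemFactor_of_order (hD : IsProductBase D) {w : ℂ} (hw : w ∈ D) (n : ℕ) :
    ∀ F : ℂ → OctonionC, IsStem D F → HolomorphicStem D F →
      (∃ g : ℂ → (Fin (Module.finrank ℝ Octonion) → ℂ), AnalyticAt ℂ g w ∧ g w ≠ 0 ∧
        ∀ᶠ z in 𝓝 w, coordC (F z) = (z - w) ^ n • g z) →
      ∃ H, IsStemFactor D F w n H := by
  induction n with
  | zero =>
    rintro F hs hF ⟨g, -, hg0, hg⟩
    refine ⟨F, hs, hF, fun h => hg0 ?_, fun z _ => by rw [pow_zero, smulC_one]⟩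
    have := hg.self_of_nhds
    rwa [h, map_zero, pow_zero, one_smul, eq_comm] at this
  | succ n ih =>
    rintro F hs hF ⟨g, hga, hg0, hg⟩
    have hFw : F w = 0 := by
      apply coordC.injective
      rw [hg.self_of_nhds, sub_self, pow_succ, mul_zero, zero_smul, map_zero]
    obtain ⟨F', hs', hF', hq⟩ := exists_eq_quad_smulC hD hs hF hw hFw
    have hwc : w - (starRingEnd ℂ) w ≠ 0 := by
      intro e
      have := congrArg Complex.im e
      rw [Complex.sub_im, Complex.conj_im, Complex.zero_im] at this
      exact hD.im_ne_zero w hw (by linarith)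
    have hia : AnalyticAt ℂ (fun z => (z - (starRingEnd ℂ) w)⁻¹) w :=
      (analyticAt_id.sub analyticAt_const).inv hwc
    obtain ⟨H, hH⟩ := ih F' hs' hF' ⟨fun z => (z - (starRingEnd ℂ) w)⁻¹ • g z, hia.smul hga,
      smul_ne_zero (inv_ne_zero hwc) hg0, by
        have h1 := hF'.analyticAt hD.isOpen hw
        have h2 : AnalyticAt ℂ (fun z => (z - w) ^ n • ((z - (starRingEnd ℂ) w)⁻¹ • g z)) w :=
          ((analyticAt_id.sub analyticAt_const).pow n).smul (hia.smul hga)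
        -- Cancelling `z - w` needs `z ≠ w`; the identity theorem restores the point `w`.
        refine (h1.frequently_eq_iff_eventually_eq h2).1 (Eventually.frequently ?_)
        have h3 : ∀ᶠ z in 𝓝[≠] w, z - (starRingEnd ℂ) w ≠ 0 := by
          refine mem_nhdsWithin_of_mem_nhds ?_
          exact (continuous_id.sub continuous_const).continuousAt.eventually_ne hwc
        filter_upwards [mem_nhdsWithin_of_mem_nhds hg, h3, self_mem_nhdsWithin] with z e1 e2 e3
        have e3' : z - w ≠ 0 := sub_ne_zero.2 e3
        have e4 : coordC (F z) = ((z - w) * (z - (starRingEnd ℂ) w)) • coordC (F' z) := by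
          rw [hq z, coordC_smulC, quad]
        rw [e4] at e1
        have e5 : (z - w) • (z - (starRingEnd ℂ) w) • coordC (F' z) =
            (z - w) • ((z - w) ^ n • g z) := by
          rw [← mul_smul, e1, pow_succ', mul_smul]
        have e6 := smul_right_injective _ e3' e5
        rw [smul_comm, ← e6, smul_smul, inv_mul_cancel₀ e2, one_smul]⟩
    exact ⟨H, hH.stem, hH.holo, hH.ne_zero, fun z hz => by
      rw [hq z, hH.eq z hz, ← smulC_mul, pow_succ']⟩

/-- The order at `w` is finite: otherwise `F` would vanish on the connected `D⁺`, hence on `D` by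
the stem symmetry. -/
theorem exists_isStemFactor (hD : IsProductBase D) (hs : IsStem D F) (hF : HolomorphicStem D F)
    (hne : ∃ z ∈ D, F z ≠ 0) {w : ℂ} (hw : w ∈ upper D) : ∃ n H, IsStemFactor D F w n H := by
  have ha : AnalyticOnNhd ℂ (fun z => coordC (F z)) (upper D) :=
    fun z hz => hF.analyticAt hD.isOpen hz.1
  have h : ¬ ∀ᶠ z in 𝓝 w, coordC (F z) = 0 := by
    intro h
    have h0 := ha.eqOn_zero_of_preconnected_of_eventuallyEq_zero hD.connected.isPreconnected hw h
    have h1 : ∀ z ∈ upper D, F z = 0 := fun z hz => by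
      apply coordC.injective
      rw [map_zero]
      exact h0 hz
    obtain ⟨z, hz, hzF⟩ := hne
    rcases lt_or_gt_of_ne (hD.im_ne_zero z hz) with hi | hi
    · have h2 := h1 ((starRingEnd ℂ) z) ⟨hD.conj_mem z hz, by simpa using hi⟩
      have h3 := hs _ (hD.conj_mem z hz)
      rw [Complex.conj_conj, h2] at h3
      exact hzF (h3.trans (by simp [barC]))
    · exact hzF (h1 z ⟨hz, hi⟩)
  obtain ⟨n, g, hg⟩ := (ha w hw).exists_eventuallyEq_pow_smul_nonzero_iff.2 h
  obtain ⟨H, hH⟩ := exists_isStemFactor_of_order hD hw.1 n F hs hF ⟨g, hg⟩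
  exact ⟨n, H, hH⟩

/-! ### Local uniqueness of the factor, and its nullity. -/

variable {w : ℂ} {n m : ℕ} {H K : ℂ → OctonionC}

theorem eventually_quad_ne_zero (hw : w ∈ upper D) :
    ∀ᶠ z in 𝓝[≠] w, quad w z ≠ 0 := by
  have h : ∀ᶠ z in 𝓝 w, 0 < z.im :=
    Complex.continuous_im.continuousAt.eventually (lt_mem_nhds hw.2)
  filter_upwards [mem_nhdsWithin_of_mem_nhds h, self_mem_nhdsWithin] with z h1 h2
  exact quad_ne_zero hw.2 h1 h2

/-- If `m > n`, cancelling the `n`-th power and letting `z → w` would give `H w = 0`. -/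
theorem IsStemFactor.order_le (hD : IsProductBase D) (hw : w ∈ upper D)
    (hH : IsStemFactor D F w n H) (hK : IsStemFactor D F w m K) : m ≤ n := by
  by_contra! hlt
  have hDw := hD.isOpen.mem_nhds hw.1
  have t1 := ((hH.holo.continuousOn).continuousAt hDw).tendsto.mono_left
    (nhdsWithin_le_nhds (s := {w}ᶜ))
  have hc : Continuous fun p : ℂ × OctonionC => smulC p.1 p.2 := by
    unfold smulC iotaC
    fun_prop
  have hq : ContinuousAt (fun z => quad w z ^ (m - n)) w := by
    unfold quad
    fun_prop
  have t2 := (hc.continuousAt.comp (hq.prodMk ((hK.holo.continuousOn).continuousAt hDw))).tendsto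
    |>.mono_left (nhdsWithin_le_nhds (s := {w}ᶜ))
  have he : H w = smulC (quad w w ^ (m - n)) (K w) := by
    refine tendsto_nhds_unique (t1.congr' ?_) t2
    filter_upwards [eventually_quad_ne_zero hw, mem_nhdsWithin_of_mem_nhds hDw]
      with z h1 h2
    apply smulC_right_injective (pow_ne_zero n h1)
    change _ = smulC _ (smulC _ _)
    rw [← hH.eq z h2, ← smulC_mul, ← pow_add, Nat.add_sub_cancel' hlt.le, hK.eq z h2]
  rw [quad_self, zero_pow (Nat.sub_ne_zero_of_lt hlt)] at he
  exact hH.ne_zero (he.trans (by simp [smulC]))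

theorem IsStemFactor.order_eq (hD : IsProductBase D) (hw : w ∈ upper D)
    (hH : IsStemFactor D F w n H) (hK : IsStemFactor D F w m K) : n = m :=
  le_antisymm (hK.order_le hD hw hH) (hH.order_le hD hw hK)

theorem IsStemFactor.eventuallyEq (hD : IsProductBase D) (hw : w ∈ upper D)
    (hH : IsStemFactor D F w n H) (hK : IsStemFactor D F w m K) : H =ᶠ[𝓝 w] K := by
  obtain rfl := hH.order_eq hD hw hK
  have h1 := hH.holo.analyticAt hD.isOpen hw.1
  have h2 := hK.holo.analyticAt hD.isOpen hw.1
  have h3 : ∀ᶠ z in 𝓝 w, coordC (H z) = coordC (K z) := by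
    refine (h1.frequently_eq_iff_eventually_eq h2).1 (Eventually.frequently ?_)
    filter_upwards [eventually_quad_ne_zero hw,
      mem_nhdsWithin_of_mem_nhds (hD.isOpen.mem_nhds hw.1)] with z e1 e2
    rw [smulC_right_injective (pow_ne_zero n e1) ((hH.eq z e2).symm.trans (hK.eq z e2))]
  filter_upwards [h3] with z hz
  exact coordC.injective hz

theorem IsStemFactor.order_pos_iff (hw : w ∈ upper D) (hH : IsStemFactor D F w n H) :
    0 < n ↔ F w = 0 := by
  rw [hH.eq w hw.1, quad_self]
  rcases Nat.eq_zero_or_pos n with rfl | h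
  · simpa [smulC_one] using hH.ne_zero
  · simpa [zero_pow h.ne', smulC] using h

/-- The quotient of a null function is null. -/
theorem IsStemFactor.normC_eq_zero (hD : IsProductBase D) (hw : w ∈ upper D)
    (hH : IsStemFactor D F w n H) (hF : ∀ z ∈ D, normC (F z) = 0) : normC (H w) = 0 := by
  have hDw := hD.isOpen.mem_nhds hw.1
  have t1 := (continuous_normC.continuousAt.comp
    (hH.holo.continuousOn.continuousAt hDw)).tendsto.mono_left (nhdsWithin_le_nhds (s := {w}ᶜ))
  refine tendsto_nhds_unique t1 ((tendsto_const_nhds (x := (0 : ℂ))).congr' ?_)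
  filter_upwards [eventually_quad_ne_zero hw, mem_nhdsWithin_of_mem_nhds hDw]
    with z h1 h2
  have h3 := hF z h2
  rw [hH.eq z h2, normC_smulC] at h3
  exact ((mul_eq_zero.1 h3).resolve_left (pow_ne_zero 2 (pow_ne_zero n h1))).symm

/-- For a holomorphic stem function, `∂F/∂z` equals `∂F/∂α`. -/
theorem sliceDeriv_phi {f : Octonion → Octonion} {J : Octonion} (hD : IsOpen D) (hs : IsStem D F)
    (hi : Induces D F f) (hF : HolomorphicStem D F) (hz : z ∈ upper D) (hJ : J ∈ imUnits) :
    sliceDeriv D f (phi J z) = phiC J (fderiv ℝ F z 1) := by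
  have he : stemFn D f =ᶠ[𝓝 z] F := by
    filter_upwards [hD.mem_nhds hz.1] with y hy
    exact stemFn_eqOn hs hi hJ hy
  rw [sliceDeriv, induce_phi hz.2 hJ, he.fderiv_eq, hF.fderiv_I hz.1, iotaC_iotaC]
  congr 1
  module

end Holomorphic

end Slice

namespace Slice

open Octonion Filter Topology

/-! ### Wings in terms of stem functions -/

/-- `G` is the stem function of `f - c`, where `f` admits the wing `W_{f,c}`. -/
structure IsWingStem (D : Set ℂ) (f : Octonion → Octonion) (c : Octonion) (G : ℂ → OctonionC) :
    Prop where
  stem : IsStem D G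
  holo : HolomorphicStem D G
  null : ∀ z ∈ D, normC (G z) = 0
  eq : ∀ z ∈ D, ∀ J ∈ imUnits, f (phi J z) = c + phiC J (G z)
  exists_ne : ∃ z ∈ D, G z ≠ 0

section Wing

variable {D : Set ℂ} {f : Octonion → Octonion} {c : Octonion} {G H : ℂ → OctonionC}
  {z : ℂ} {I J : Octonion} {n : ℕ}

theorem AdmitsWing.exists_isWingStem (hD : IsProductBase D) (hf : AdmitsWing D f c)
    (hI : I ∈ imUnits) : ∃ G, IsWingStem D f c G := by
  obtain ⟨F, hs, hi, hF⟩ := hf.regular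
  have hsG : IsStem D fun z => F z - (c, 0) := fun z hz => by
    have := hs z hz
    simp only [this]
    apply Prod.ext <;> simp [barC]
  have heq : ∀ z ∈ D, ∀ J ∈ imUnits, f (phi J z) - c = phiC J (F z - (c, 0)) := fun z hz J hJ => by
    rw [hi z hz J hJ]
    simp only [phiC, Prod.fst_sub, Prod.snd_sub, sub_zero]
    abel
  refine ⟨fun z => F z - (c, 0), hsG, ?_, ?_, fun z hz J hJ => ?_, ?_⟩
  · rw [holomorphicStem_iff hD.isOpen] at hF ⊢
    simp only [map_sub]
    exact hF.sub (differentiableOn_const _)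
  · have hst := stemFn_eqOn (f := fun y => f y - c) hsG heq hI
    -- `N(f - c)` vanishes on the slices of `I` and `-I`, which forces its stem function to vanish
    -- on `D⁺`; the lower half follows by symmetry.
    have h0 : ∀ z ∈ upper D, normC (F z - (c, 0)) = 0 := by
      intro z hz
      have key : ∀ J ∈ imUnits, phiC J (mulC (F z - (c, 0)) (starC (F z - (c, 0)))) =
          phiC J 0 := fun J hJ => by
        have := hf.normal_eq_zero (phi J z) (phi_mem_circ hz.1 hJ)
        rw [normalFn, induce_phi hz.2 hJ, hst hz.1] at this
        rw [this]
        simp [phiC]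
      have h := eq_of_phiC_eq hI (key I hI) (key _ (neg_mem_imUnits hI))
      rw [mulC_starC, Prod.ext_iff] at h
      have h1 := congrArg re h.1
      have h2 := congrArg re h.2
      apply Complex.ext
      · simpa using h1
      · simpa using h2
    intro z hz
    rcases lt_or_gt_of_ne (hD.im_ne_zero z hz) with h | h
    · have h1 := h0 ((starRingEnd ℂ) z) ⟨hD.conj_mem z hz, by simpa using h⟩
      have h2 := hsG z hz
      simp only at h2
      rw [h2] at h1
      have h3 := congrArg Complex.re h1
      have h4 := congrArg Complex.im h1
      apply Complex.ext
      · simpa [normC, barC] using h3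
      · simpa [normC, barC] using h4
    · exact h0 z ⟨hz, h⟩
  · rw [← heq z hz J hJ]
    abel
  · by_contra! h
    refine hf.nonconstant ⟨c, ?_⟩
    rintro x ⟨z, hz, J, hJ, rfl⟩
    rw [← sub_eq_zero, heq z hz J hJ, h z hz]
    simp [phiC]

theorem IsWingStem.induces (hG : IsWingStem D f c G) :
    Induces D (fun z => G z + (c, 0)) f := fun z hz J hJ => by
  rw [hG.eq z hz J hJ]
  simp only [phiC, Prod.fst_add, Prod.snd_add, add_zero]
  abel

theorem IsWingStem.isStem (hG : IsWingStem D f c G) : IsStem D fun z => G z + (c, 0) :=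
  fun z hz => by
    simp only [hG.stem z hz]
    apply Prod.ext <;> simp [barC]

theorem IsWingStem.holomorphicStem (hD : IsOpen D) (hG : IsWingStem D f c G) :
    HolomorphicStem D fun z => G z + (c, 0) := by
  have h := hG.holo
  rw [holomorphicStem_iff hD] at h ⊢
  simp only [map_add]
  exact h.add (differentiableOn_const _)

/-- A null vector with zero second component is zero, so the degenerate spheres are exactly those on
which `f` is constantly `c`. -/
theorem IsWingStem.sphDeriv_eq_zero_iff (hG : IsWingStem D f c G) (hz : z ∈ upper D)
    (hJ : J ∈ imUnits) : sphDeriv f (phi J z) = 0 ↔ G z = 0 := by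
  rw [sphDeriv_phi hG.induces hz.1 hJ, smul_eq_zero]
  have h1 : z.im⁻¹ ≠ 0 := inv_ne_zero hz.2.ne'
  simp only [h1, Prod.snd_add, add_zero, false_or]
  refine ⟨fun h => ?_, fun h => by rw [h]; rfl⟩
  by_contra hne
  exact snd_ne_zero_of_normC (hG.null z hz.1) hne h

theorem IsWingStem.mem_degSet_iff (hG : IsWingStem D f c G) (hz : z ∈ upper D)
    (hJ : J ∈ imUnits) : phi J z ∈ degSet D f ↔ G z = 0 := by
  rw [← hG.sphDeriv_eq_zero_iff hz hJ]
  refine ⟨fun h => h.2.2, fun h => ⟨phi_mem_circ hz.1 hJ, ?_, h⟩⟩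
  rw [im_phi hJ]
  exact smul_ne_zero hz.2.ne' (ne_zero_of_mem_imUnits hJ)

theorem IsWingStem.exists_isStemFactor (hD : IsProductBase D) (hG : IsWingStem D f c G)
    (hz : z ∈ upper D) : ∃ n H, IsStemFactor D G z n H :=
  Slice.exists_isStemFactor hD hG.stem hG.holo hG.exists_ne hz

theorem IsWingStem.isStemFactor_zero (hG : IsWingStem D f c G) (hz : G z ≠ 0) :
    IsStemFactor D G z 0 G :=
  ⟨hG.stem, hG.holo, hz, fun y _ => by rw [pow_zero, smulC_one]⟩

theorem IsWingStem.isWingFactor_iff (hG : IsWingStem D f c G) (hz : z ∈ upper D)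
    (hJ : J ∈ imUnits) {h : Octonion → Octonion} :
    IsWingFactor D f c z J n h ↔ 0 < n ∧ ∃ H, IsStemFactor D G z n H ∧ Induces D H h := by
  have key : ∀ H, Induces D H h → ∀ y ∈ D, ∀ K ∈ imUnits,
      (f (phi K y) = c + npow (Delta (phi J z) (phi K y)) n * h (phi K y) ↔
        phiC K (G y) = phiC K (smulC (quad z y ^ n) (H y))) := by
    intro H hi y hy K hK
    rw [hG.eq y hy K hK, Delta_phi hJ hK, npow_phi hK, hi y hy K hK, ← phiC_smulC hK,
      add_right_inj]
  constructor
  · rintro ⟨hn, ⟨H, hs, hi, hH⟩, heq, x, ⟨K, hK, rfl⟩, hx⟩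
    refine ⟨hn, H, ⟨hs, hH, fun h0 => hx ?_, fun y hy => ?_⟩, hi⟩
    · rw [hi z hz.1 K hK, h0]
      simp [phiC]
    · have hJ' := neg_mem_imUnits hJ
      exact eq_of_phiC_eq hJ ((key H hi y hy J hJ).1 (heq _ (phi_mem_circ hy hJ)))
        ((key H hi y hy _ hJ').1 (heq _ (phi_mem_circ hy hJ')))
  · rintro ⟨hn, H, hH, hi⟩
    refine ⟨hn, ⟨H, hH.stem, hi, hH.holo⟩, ?_, ?_⟩
    · rintro x ⟨y, hy, K, hK, rfl⟩
      exact (key H hi y hy K hK).2 (by rw [hH.eq y hy])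
    · by_contra! h0
      have hJ' := neg_mem_imUnits hJ
      have e1 := h0 _ ⟨J, hJ, rfl⟩
      have e2 := h0 _ ⟨-J, hJ', rfl⟩
      rw [hi z hz.1 J hJ] at e1
      rw [hi z hz.1 _ hJ'] at e2
      exact hH.ne_zero (eq_of_phiC_eq hJ (e1.trans (by simp [phiC])) (e2.trans (by simp [phiC])))

theorem IsWingStem.exists_isWingFactor (hD : IsProductBase D) (hG : IsWingStem D f c G)
    (hz : z ∈ upper D) (hJ : J ∈ imUnits) (h0 : G z = 0) : ∃ n h, IsWingFactor D f c z J n h := by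
  obtain ⟨n, H, hH⟩ := hG.exists_isStemFactor hD hz
  exact ⟨n, induce H, (hG.isWingFactor_iff hz hJ).2 ⟨(hH.order_pos_iff hz).2 h0, H, hH,
    induces_induce hD.im_ne_zero hH.stem⟩⟩

theorem phi_unitRoot (z : ℂ) (w : OctonionC) :
    phi (unitRoot w) z = z.re • (1 : Octonion) - w.1 * (z.im⁻¹ • w.2)⁻¹ := by
  rw [phi, unitRoot, smul_inv', inv_inv, mul_smul_comm, smul_neg, sub_eq_add_neg]

theorem IsWingStem.eq_phi_of_isWingFactor (hD : IsProductBase D) (hG : IsWingStem D f c G)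
    (hz : z ∈ upper D) (hJ : J ∈ imUnits) (hH : IsStemFactor D G z n H) {m : ℕ}
    {h : Octonion → Octonion} (hh : IsWingFactor D f c z J m h) :
    z.re • (1 : Octonion) - sphValue h (phi J z) * (sphDeriv h (phi J z))⁻¹ =
      phi (unitRoot (H z)) z := by
  obtain ⟨-, K, hK, hi⟩ := (hG.isWingFactor_iff hz hJ).1 hh
  rw [(hH.eventuallyEq hD hz hK).self_of_nhds, phi_unitRoot, sphValue_phi hi hz.1 hJ,
    sphDeriv_phi hi hz.1 hJ]

/-- Both branches of the definition give the root of the local factor, with `n = 0` and `H = G` near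
`z` in the nondegenerate case. The value found does not involve `I`. -/
theorem IsWingStem.wingMap_eq (hD : IsProductBase D) (hG : IsWingStem D f c G)
    (hz : z ∈ upper D) (hI : I ∈ imUnits) (hH : IsStemFactor D G z n H) :
    wingMap D f c I z = phi (unitRoot (H z)) z := by
  by_cases h0 : G z = 0
  · have hs := (hG.sphDeriv_eq_zero_iff hz hI).2 h0
    rw [wingMap, if_neg (not_not.2 hs)]
    obtain ⟨m, h, hh⟩ := hG.exists_isWingFactor hD hz hI h0
    exact hG.eq_phi_of_isWingFactor hD hz hI hH
      (Classical.epsilon_spec (p := fun p : ℕ × (Octonion → Octonion) =>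
        IsWingFactor D f c z I p.1 p.2) ⟨(m, h), hh⟩)
  · rw [wingMap, if_pos (mt (hG.sphDeriv_eq_zero_iff hz hI).1 h0),
      (hH.eventuallyEq hD hz (hG.isStemFactor_zero h0)).self_of_nhds, phi_unitRoot,
      sphValue_phi hG.induces hz.1 hI, sphDeriv_phi hG.induces hz.1 hI]
    simp only [Prod.fst_add, Prod.snd_add, add_zero]
    rw [show c - ((G z).1 + c) = -(G z).1 by abel, neg_mul, sub_eq_add_neg]

theorem IsWingStem.unitRoot_mem (hD : IsProductBase D) (hG : IsWingStem D f c G)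
    (hz : z ∈ upper D) (hH : IsStemFactor D G z n H) : unitRoot (H z) ∈ imUnits :=
  Slice.unitRoot_mem (hH.normC_eq_zero hD hz hG.null) hH.ne_zero

theorem IsWingStem.snd_ne_zero (hD : IsProductBase D) (hG : IsWingStem D f c G)
    (hz : z ∈ upper D) (hH : IsStemFactor D G z n H) : (H z).2 ≠ 0 :=
  snd_ne_zero_of_normC (hH.normC_eq_zero hD hz hG.null) hH.ne_zero

theorem IsWingStem.exists_wingMap_eq (hD : IsProductBase D) (hG : IsWingStem D f c G)
    (hz : z ∈ upper D) (hI : I ∈ imUnits) : ∃ J ∈ imUnits, wingMap D f c I z = phi J z := by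
  obtain ⟨n, H, hH⟩ := hG.exists_isStemFactor hD hz
  exact ⟨_, hG.unitRoot_mem hD hz hH, hG.wingMap_eq hD hz hI hH⟩

theorem IsWingStem.apply_wingMap (hD : IsProductBase D) (hG : IsWingStem D f c G)
    (hz : z ∈ upper D) (hI : I ∈ imUnits) : f (wingMap D f c I z) = c := by
  obtain ⟨n, H, hH⟩ := hG.exists_isStemFactor hD hz
  have hJ := hG.unitRoot_mem hD hz hH
  rw [hG.wingMap_eq hD hz hI hH, hG.eq z hz.1 _ hJ, hH.eq z hz.1, phiC_smulC hJ,
    phiC_unitRoot (hG.snd_ne_zero hD hz hH), mul_zero, add_zero]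

theorem IsWingStem.eq_wingMap (hD : IsProductBase D) (hG : IsWingStem D f c G)
    (hz : z ∈ upper D) (hI : I ∈ imUnits) (hJ : J ∈ imUnits) (h0 : G z ≠ 0)
    (hf : f (phi J z) = c) : phi J z = wingMap D f c I z := by
  rw [hG.wingMap_eq hD hz hI (hG.isStemFactor_zero h0)]
  congr 1
  rw [hG.eq z hz.1 J hJ, add_eq_left] at hf
  exact eq_unitRoot (snd_ne_zero_of_normC (hG.null z hz.1) h0) hf

/-- Near `z`, the map `ω` is determined by the factor of `f - c` at `z`. -/
theorem IsWingStem.wingMap_eventuallyEq (hD : IsProductBase D) (hG : IsWingStem D f c G)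
    (hz : z ∈ upper D) (hI : I ∈ imUnits) (hH : IsStemFactor D G z n H) :
    wingMap D f c I =ᶠ[𝓝 z] fun y => phi (unitRoot (H y)) y := by
  have h1 : ∀ᶠ y in 𝓝 z, H y ≠ 0 :=
    (hH.holo.continuousOn.continuousAt (hD.isOpen.mem_nhds hz.1)).eventually_ne hH.ne_zero
  filter_upwards [h1, (isOpen_upper hD.isOpen).mem_nhds hz] with y hy hyD
  rcases eq_or_ne y z with rfl | hne
  · exact hG.wingMap_eq hD hz hI hH
  · have hq := pow_ne_zero n (quad_ne_zero hz.2 hyD.2 hne)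
    have hGy : G y ≠ 0 := by
      rw [hH.eq y hyD.1]
      exact smulC_ne_zero hq hy
    have hn : normC (H y) = 0 := by
      have h3 := hG.null y hyD.1
      rw [hH.eq y hyD.1, normC_smulC] at h3
      exact (mul_eq_zero.1 h3).resolve_left (pow_ne_zero 2 hq)
    rw [hG.wingMap_eq hD hyD hI (hG.isStemFactor_zero hGy), hH.eq y hyD.1,
      unitRoot_smulC hq hn hy]

/-- Local uniqueness of the factor lets any `H` compute `a` and `b`, on and off `D_f` alike. -/
theorem IsWingStem.isWingData_iff (hD : IsProductBase D) (hG : IsWingStem D f c G)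
    (hz : z ∈ upper D) (hJ : J ∈ imUnits) (hH : IsStemFactor D G z n H) {a b : Octonion} :
    IsWingData D f c z J a b ↔ a = phiC J (fderiv ℝ H z 1) ∧ b = z.im⁻¹ • (H z).2 := by
  rw [IsWingData, hG.mem_degSet_iff hz hJ]
  by_cases h0 : G z = 0
  · simp only [h0, not_true_eq_false, false_and, true_and, false_or]
    constructor
    · rintro ⟨m, h, hh, rfl, rfl⟩
      obtain ⟨-, K, hK, hi⟩ := (hG.isWingFactor_iff hz hJ).1 hh
      have he := hH.eventuallyEq hD hz hK
      rw [he.fderiv_eq, he.self_of_nhds, sliceDeriv_phi hD.isOpen hK.stem hi hK.holo hz hJ,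
        sphDeriv_phi hi hz.1 hJ]
      exact ⟨rfl, rfl⟩
    · rintro ⟨rfl, rfl⟩
      have hi := induces_induce hD.im_ne_zero hH.stem
      refine ⟨n, induce H, (hG.isWingFactor_iff hz hJ).2 ⟨(hH.order_pos_iff hz).2 h0, H, hH, hi⟩,
        ?_, ?_⟩
      · rw [sliceDeriv_phi hD.isOpen hH.stem hi hH.holo hz hJ]
      · rw [sphDeriv_phi hi hz.1 hJ]
  · simp only [h0, not_false_eq_true, true_and, false_and, or_false]
    have he := hH.eventuallyEq hD hz (hG.isStemFactor_zero h0)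
    rw [he.fderiv_eq, he.self_of_nhds, sliceDeriv_phi hD.isOpen hG.isStem hG.induces
      (hG.holomorphicStem hD.isOpen) hz hJ, sphDeriv_phi hG.induces hz.1 hJ, fderiv_add_const]
    simp

theorem contDiffAt_unitRoot {w : OctonionC} (h : w.2 ≠ 0) :
    ContDiffAt ℝ (⊤ : WithTop ℕ∞) unitRoot w := by
  have e : unitRoot = fun w : OctonionC =>
      -(mulL w.1 ((‖w.2‖ ^ 2)⁻¹ • starL w.2)) := rfl
  rw [e]
  have h1 : ContDiffAt ℝ (⊤ : WithTop ℕ∞) (fun w : OctonionC => (‖w.2‖ ^ 2)⁻¹ • starL w.2) w := by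
    refine ContDiffAt.smul (ContDiffAt.inv (contDiffAt_snd.norm_sq ℝ) ?_)
      (starL.contDiff.contDiffAt.comp w contDiffAt_snd)
    exact pow_ne_zero 2 (norm_ne_zero_iff.2 h)
  exact ((mulL.contDiff.contDiffAt.comp w contDiffAt_fst).clm_apply h1).neg

theorem phi_mul_comm_I (hJ : J ∈ imUnits) (v : ℂ) (x : Octonion) :
    phi J (Complex.I * v) * x = J * (phi J v * x) := by
  simp only [phi, Complex.mul_re, Complex.mul_im, Complex.I_re, Complex.I_im, add_mul, mul_add,
    smul_mul_assoc, mul_smul_comm, one_mul, imUnits_mul_mul hJ]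
  module

theorem IsWingStem.contDiffAt_wingMap (hD : IsProductBase D) (hG : IsWingStem D f c G)
    (hz : z ∈ upper D) (hI : I ∈ imUnits) :
    ContDiffAt ℝ (⊤ : WithTop ℕ∞) (wingMap D f c I) z := by
  obtain ⟨n, H, hH⟩ := hG.exists_isStemFactor hD hz
  refine ContDiffAt.congr_of_eventuallyEq ?_ (hG.wingMap_eventuallyEq hD hz hI hH)
  have h1 : ContDiffAt ℝ (⊤ : WithTop ℕ∞) (fun y => unitRoot (H y)) z :=
    (contDiffAt_unitRoot (hG.snd_ne_zero hD hz hH)).comp z (hH.holo.contDiffAt hD.isOpen hz.1)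
  exact (ContDiffAt.smul Complex.reCLM.contDiff.contDiffAt contDiffAt_const).add
    (ContDiffAt.smul Complex.imCLM.contDiff.contDiffAt h1)

/-- With `ω(y) = φ_{J(y)}(y)` one has `dω(v) = φ_J(v) + β dJ(v)`, and `β dJ(v) b = dJ(v) H₂` is
found by differentiating the equation of the root. Multiplying by `b` on the right avoids
differentiating an inverse. -/
theorem IsWingStem.fderiv_wingMap_mul (hD : IsProductBase D) (hG : IsWingStem D f c G)
    (hz : z ∈ upper D) (hI : I ∈ imUnits) {a b : Octonion} (hJ : J ∈ imUnits)
    (hzJ : wingMap D f c I z = phi J z) (hab : IsWingData D f c z J a b) (v : ℂ) :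
    fderiv ℝ (wingMap D f c I) z v * b = phi J v * (b - a) := by
  obtain ⟨n, H, hH⟩ := hG.exists_isStemFactor hD hz
  have hJH : J = unitRoot (H z) := by
    rw [hG.wingMap_eq hD hz hI hH] at hzJ
    exact (phi_injective hz.2 hz.2 hJ (hG.unitRoot_mem hD hz hH) hzJ.symm).2
  obtain ⟨rfl, rfl⟩ := (hG.isWingData_iff hD hz hJ hH).1 hab
  have h2 := hG.snd_ne_zero hD hz hH
  have hHd := (hH.holo.differentiableAt hD.isOpen hz.1).hasFDerivAt
  set L := fderiv ℝ H z
  have hU : HasFDerivAt (fun y => unitRoot (H y)) (fderiv ℝ (fun y => unitRoot (H y)) z) z :=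
    (((contDiffAt_unitRoot h2).comp z (hH.holo.contDiffAt hD.isOpen hz.1)).differentiableAt
      (by simp)).hasFDerivAt
  set U := fderiv ℝ (fun y => unitRoot (H y)) z
  have hω : fderiv ℝ (wingMap D f c I) z v = v.re • (1 : Octonion) + (z.im • U v + v.im • J) := by
    rw [(hG.wingMap_eventuallyEq hD hz hI hH).fderiv_eq]
    have h3 := ((Complex.reCLM.hasFDerivAt (x := z)).smul_const (1 : Octonion)).add
      ((Complex.imCLM.hasFDerivAt (x := z)).smul hU)
    have h4 : HasFDerivAt (fun y => phi (unitRoot (H y)) y) _ z := h3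
    rw [h4.fderiv, hJH]
    simp
  -- The derivative of `H₁ + J(y) H₂ = 0`, an identity that holds near `z`.
  have hroot : (L v).1 + J * (L v).2 + U v * (H z).2 = 0 := by
    have h3 := (hHd.fst).add (mulL.hasFDerivAt_of_bilinear hU hHd.snd)
    have h4 : (fun y => (H y).1 + mulL (unitRoot (H y)) (H y).2) =ᶠ[𝓝 z] fun _ => 0 := by
      have h5 : ∀ᶠ y in 𝓝 z, (H y).2 ≠ 0 :=
        hHd.snd.continuousAt.eventually_ne h2
      filter_upwards [h5] with y hy
      exact phiC_unitRoot hy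
    have h6 := (h3.congr_of_eventuallyEq h4.symm).unique (hasFDerivAt_const (0 : Octonion) z)
    have h7 := congrArg (fun T => T v) h6
    rw [hJH, add_assoc]
    simpa using h7
  -- Cauchy-Riemann: the real differential of `H` is complex linear.
  have hLv : L v = smulC v (L 1) := by
    have : v = v.re • (1 : ℂ) + v.im • Complex.I := by
      simp [Complex.re_add_im]
    conv_lhs => rw [this]
    rw [map_add, map_smul, map_smul, hH.holo.fderiv_I hz.1, smulC]
  have hLa : (L v).1 + J * (L v).2 = phi J v * phiC J (L 1) := by
    rw [← phiC_smulC hJ, ← hLv, phiC]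
  have h8 : U v * (H z).2 = -(phi J v * phiC J (L 1)) := by
    rw [← hLa]
    exact (neg_eq_of_add_eq_zero_right hroot).symm
  rw [hω, mul_sub, phi, add_mul, add_mul]
  rw [show z.im • U v * z.im⁻¹ • (H z).2 = U v * (H z).2 by
    rw [smul_mul_assoc, mul_smul_comm, smul_smul, mul_inv_cancel₀ hz.2.ne', one_smul], h8, phi,
    add_mul, add_mul]
  abel

end Wing

end Slice

/-! ### The half-plane coordinate, a left inverse of every section `z ↦ φ_{J(z)}(z)`. -/

namespace Slice

open Octonion Filter Topology

/-- The point `α + iβ`, `β ≥ 0`, of the half-plane such that `x ∈ α + β 𝕊`. -/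
noncomputable def proj (x : Octonion) : ℂ := ⟨x.re, ‖x.im‖⟩

theorem proj_phi {J : Octonion} (hJ : J ∈ imUnits) {z : ℂ} (hz : 0 < z.im) :
    proj (phi J z) = z := by
  rw [proj, re_phi hJ, norm_im_phi hJ, abs_of_pos hz]

theorem proj_eq (x : Octonion) : proj x = ((reL x : ℝ) : ℂ) + ((‖imL x‖ : ℝ) : ℂ) * Complex.I := by
  apply Complex.ext <;> simp [proj]

theorem continuous_proj : Continuous proj := by
  rw [show proj = _ from funext proj_eq]
  fun_prop

theorem contDiffAt_proj {x : Octonion} (hx : x.im ≠ 0) : ContDiffAt ℝ (⊤ : ℕ∞) proj x := by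
  rw [show proj = _ from funext proj_eq]
  have h1 : ContDiffAt ℝ (⊤ : ℕ∞) (fun x => ‖imL x‖) x := imL.contDiff.contDiffAt.norm ℝ hx
  exact (Complex.ofRealCLM.contDiff.contDiffAt.comp x reL.contDiff.contDiffAt).add
    ((Complex.ofRealCLM.contDiff.contDiffAt.comp x h1).mul contDiffAt_const)

/-! ### Surfaces parametrized over a plane domain -/

section Surface

variable {U : Set ℂ} {g : ℂ → Octonion} {π : Octonion → ℂ} {z : ℂ}

/-- A curve `γ` in the image satisfies `γ = g ∘ π ∘ γ`, so the chain rule puts its velocity in the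
range of `dg`; images of line segments give the converse. -/
theorem tangentAt_image (hU : IsOpen U) (hz : z ∈ U) (hg : ContDiffAt ℝ (⊤ : ℕ∞) g z)
    (hπ : ContDiffAt ℝ (⊤ : ℕ∞) π (g z)) (hπg : ∀ y ∈ U, π (g y) = y) :
    tangentAt (g '' U) (g z) = Set.range (fderiv ℝ g z) := by
  have hgd : HasFDerivAt g (fderiv ℝ g z) z := (hg.differentiableAt (by simp)).hasFDerivAt
  ext v
  constructor
  · rintro ⟨γ, h0, hγ, rfl, hW⟩
    have hγd : HasDerivAt γ (deriv γ 0) 0 := (hγ.differentiableAt (by simp)).hasDerivAt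
    have hπd : HasFDerivAt π (fderiv ℝ π (g z)) (γ 0) := by
      rw [h0]
      exact (hπ.differentiableAt (by simp)).hasFDerivAt
    have h1 : HasDerivAt (π ∘ γ) (fderiv ℝ π (g z) (deriv γ 0)) 0 := hπd.comp_hasDerivAt 0 hγd
    have hgd' : HasFDerivAt g (fderiv ℝ g z) ((π ∘ γ) 0) := by
      rwa [Function.comp_apply, h0, hπg z hz]
    have h2 := hgd'.comp_hasDerivAt 0 h1
    have h3 : γ =ᶠ[𝓝 0] g ∘ π ∘ γ := by
      filter_upwards [hW] with t ht
      obtain ⟨y, hy, hyt⟩ := ht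
      rw [Function.comp_apply, Function.comp_apply, ← hyt, hπg y hy]
    exact ⟨_, (h2.congr_of_eventuallyEq h3).unique hγd⟩
  · rintro ⟨v, rfl⟩
    have hl : ContDiff ℝ (⊤ : ℕ∞) fun t : ℝ => z + t • v := by fun_prop
    have hld : HasDerivAt (fun t : ℝ => z + t • v) v 0 := by
      simpa using ((hasDerivAt_id (0 : ℝ)).smul_const v).const_add z
    have e0 : z + (0 : ℝ) • v = z := by simp
    refine ⟨fun t => g (z + t • v), by simp, ?_, ?_, ?_⟩
    · exact ContDiffAt.comp (g := g) (f := fun t : ℝ => z + t • v) 0 (by rwa [e0]) hl.contDiffAt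
    · have hgd' : HasFDerivAt g (fderiv ℝ g z) (z + (0 : ℝ) • v) := by rwa [e0]
      exact (hgd'.comp_hasDerivAt 0 hld).deriv
    · have : ∀ᶠ t : ℝ in 𝓝 0, z + t • v ∈ U :=
        hl.continuous.continuousAt.eventually_mem (by rw [e0]; exact hU.mem_nhds hz)
      filter_upwards [this] with t ht
      exact Set.mem_image_of_mem g ht

/-- The curve normalizes `J + t u`. As `u ⊥ J`, its squared norm is `1 + t²‖u‖²`, so the normalizing
factor has zero derivative at `0`. -/
theorem mem_tangentAt_sphere {J : Octonion} (hJ : J ∈ imUnits) (z : ℂ) {u : Octonion}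
    (hu : u.re = 0) (hJu : inner ℝ J u = (0 : ℝ)) :
    z.im • u ∈ tangentAt (sphere z) (phi J z) := by
  have hn : ∀ t : ℝ, ‖J + t • u‖ ^ 2 = 1 + t ^ 2 * ‖u‖ ^ 2 := fun t => by
    rw [norm_add_sq_real, norm_of_mem_imUnits hJ, inner_smul_right, hJu, norm_smul, mul_pow,
      Real.norm_eq_abs, sq_abs]
    ring
  have hpos : ∀ t : ℝ, 0 < 1 + t ^ 2 * ‖u‖ ^ 2 := fun t => by positivity
  set s : ℝ → ℝ := fun t => (√(1 + t ^ 2 * ‖u‖ ^ 2))⁻¹ with hs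
  have hsm : ContDiff ℝ (⊤ : ℕ∞) s := by
    refine ContDiff.inv (ContDiff.sqrt (by fun_prop) fun t => (hpos t).ne') fun t => ?_
    exact (Real.sqrt_pos.2 (hpos t)).ne'
  have hs0 : s 0 = 1 := by simp [hs]
  have hsd : HasDerivAt s 0 0 := by
    have h1 : HasDerivAt (fun t : ℝ => 1 + t ^ 2 * ‖u‖ ^ 2) 0 0 := by
      simpa using ((hasDerivAt_pow 2 (0 : ℝ)).mul_const (‖u‖ ^ 2)).const_add 1
    have h2 := (h1.sqrt (hpos 0).ne').inv (Real.sqrt_pos.2 (hpos 0)).ne'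
    simpa [hs, Pi.inv_def] using h2
  refine ⟨fun t => phi (s t • (J + t • u)) z, by simp [hs0], ?_, ?_, ?_⟩
  · have : ContDiff ℝ (⊤ : ℕ∞) fun t => phi (s t • (J + t • u)) z := by
      unfold phi
      fun_prop
    exact this.contDiffAt
  · have h1 : HasDerivAt (fun t : ℝ => J + t • u) u 0 := by
      simpa using ((hasDerivAt_id (0 : ℝ)).smul_const u).const_add J
    have h2 := ((hsd.smul h1).const_smul z.im).const_add (z.re • (1 : Octonion))
    have h3 : HasDerivAt (fun t => phi (s t • (J + t • u)) z) _ 0 := h2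
    rw [h3.deriv, hs0]
    simp
  · refine Eventually.of_forall fun t => ⟨_, mem_imUnits.2 ⟨?_, ?_⟩, rfl⟩
    · simp [re_of_mem_imUnits hJ, hu]
    · have h1 : ‖J + t • u‖ = √(1 + t ^ 2 * ‖u‖ ^ 2) := by
        rw [← hn t, Real.sqrt_sq (norm_nonneg _)]
      have h2 := Real.sqrt_pos.2 (hpos t)
      rw [norm_smul, h1, hs, norm_inv, Real.norm_eq_abs, abs_of_pos h2, inv_mul_cancel₀ h2.ne']

/-- A surface whose tangent space at `φ_J z` projects onto `ℂ_J` is transverse to the sphere. -/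
theorem transverseAt_sphere {J : Octonion} (hJ : J ∈ imUnits) (hz : z.im ≠ 0) {S : Set Octonion}
    (h : ∀ p q : ℝ, ∃ s ∈ tangentAt S (phi J z), s.re = p ∧ inner ℝ J s = q) :
    TransverseAt S (sphere z) (phi J z) := by
  intro v
  obtain ⟨s, hs, h1, h2⟩ := h v.re (inner ℝ J v)
  refine ⟨s, hs, z.im • (z.im⁻¹ • (v - s)), mem_tangentAt_sphere hJ z ?_ ?_, ?_⟩
  · simp [h1]
  · rw [inner_smul_right, inner_sub_right, h2, sub_self, mul_zero]
  · rw [smul_smul, mul_inv_cancel₀ hz, one_smul]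
    abel

end Surface

/-! ### The Riemann surface structure from a single global chart. -/

section Biholomorphism

variable {U : TopologicalSpace.Opens ℂ} {g : ℂ → Octonion} {π : Octonion → ℂ}

/-- The inverse of a parametrization `g : U → W`, as a chart of `W`. -/
noncomputable def inverseChart (hne : (U : Set ℂ).Nonempty) (hg : ContinuousOn g U)
    (hπ : Continuous π) (hπg : ∀ y ∈ U, π (g y) = y) :
    OpenPartialHomeomorph (g '' (U : Set ℂ)) ℂ := by
  classical
  exact
  { toFun := fun x => π x
    -- Outside the target `U` the value is an arbitrary point of the surface.
    invFun := fun z => if h : z ∈ U then ⟨g z, Set.mem_image_of_mem g h⟩ else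
      ⟨g hne.choose, Set.mem_image_of_mem g hne.choose_spec⟩
    source := Set.univ
    target := U
    map_source' := by
      rintro ⟨_, y, hy, rfl⟩ -
      change π (g y) ∈ _
      rwa [hπg y hy]
    map_target' := fun _ _ => Set.mem_univ _
    left_inv' := by
      rintro ⟨_, y, hy, rfl⟩ -
      simp [hπg y hy, show y ∈ U from hy]
    right_inv' := fun z hz => by simp [show z ∈ U from hz, hπg z hz]
    open_source := isOpen_univ
    open_target := U.isOpen
    continuousOn_toFun := (hπ.comp continuous_subtype_val).continuousOn
    continuousOn_invFun := by
      rw [Topology.IsInducing.subtypeVal.continuousOn_iff]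
      exact hg.congr fun z hz => by simp [show z ∈ U from hz] }

open Classical in
-- The inverse of `g` is a `𝒥`-holomorphic chart `e₀` defined everywhere, and every other such chart
-- is holomorphic with nonzero derivative relative to it. Transition maps are then holomorphic, and
-- `g` is biholomorphic because `e₀` is a chart.
theorem isBiholomorphism_image (hne : (U : Set ℂ).Nonempty)
    (hg : ∀ z ∈ U, ContDiffAt ℝ (⊤ : ℕ∞) g z) (hinj : ∀ z ∈ U, Function.Injective (fderiv ℝ g z))
    (hπ : Continuous π) (hπd : ∀ z ∈ U, ContDiffAt ℝ (⊤ : ℕ∞) π (g z))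
    (hπg : ∀ y ∈ U, π (g y) = y) (𝒥 : Octonion → Octonion → Octonion)
    (h𝒥 : ∀ z ∈ U, ∀ v, fderiv ℝ g z (Complex.I * v) = 𝒥 (g z) (fderiv ℝ g z v)) :
    IsBiholomorphism U (g '' (U : Set ℂ)) 𝒥 g := by
  have hgc : ContinuousOn g U := fun z hz => (hg z hz).continuousAt.continuousWithinAt
  set e₀ := inverseChart hne hgc hπ hπg with he₀
  have hsymm : ∀ z ∈ U, (e₀.symm z : Octonion) = g z := fun z hz => by
    change ((if h : z ∈ U then (⟨g z, Set.mem_image_of_mem g h⟩ : g '' (U : Set ℂ)) else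
      ⟨g hne.choose, Set.mem_image_of_mem g hne.choose_spec⟩ : g '' (U : Set ℂ)) : Octonion) = g z
    rw [dif_pos hz]
  have happ : ∀ x, e₀ x = π x := fun x => rfl
  have hsource : e₀.source = Set.univ := rfl
  have htarget : e₀.target = U := rfl
  have hsymm' : ∀ z ∈ U, (fun z => (e₀.symm z : Octonion)) =ᶠ[𝓝 z] g := fun z hz => by
    filter_upwards [U.isOpen.mem_nhds hz] with y hy
    exact hsymm y hy
  have hmem : e₀ ∈ complexCharts (g '' (U : Set ℂ)) 𝒥 := by
    refine ⟨fun z hz => ?_, fun z hz => ?_⟩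
    · exact ((hg z hz).congr_of_eventuallyEq (hsymm' z hz)).contDiffWithinAt
    · rw [(hsymm' z hz).fderiv_eq, hsymm z hz]
      exact ⟨hinj z hz, h𝒥 z hz⟩
  have hcoord : ∀ e ∈ complexCharts (g '' (U : Set ℂ)) 𝒥, ∀ z ∈ e.target,
      ∃ d : ℂ, d ≠ 0 ∧ HasDerivAt (e.symm.trans e₀) d z := by
    rintro e ⟨he1, he2⟩ z hz
    set ψ : ℂ → Octonion := fun z => (e.symm z : Octonion) with hψ
    set ζ : ℂ → ℂ := fun z => π (ψ z) with hζ
    have hψU : ∀ y, ∃ u ∈ U, g u = ψ y := fun y => (e.symm y).2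
    have hζU : ∀ y, ζ y ∈ U ∧ g (ζ y) = ψ y := fun y => by
      obtain ⟨u, hu, huy⟩ := hψU y
      rw [hζ]
      simp only [← huy, hπg u hu, and_true]
      exact hu
    have hψd : HasFDerivAt ψ (fderiv ℝ ψ z) z :=
      ((he1.contDiffAt (e.open_target.mem_nhds hz)).differentiableAt (by simp)).hasFDerivAt
    have hπz : HasFDerivAt π (fderiv ℝ π (ψ z)) (ψ z) := by
      rw [← (hζU z).2]
      exact ((hπd _ (hζU z).1).differentiableAt (by simp)).hasFDerivAt
    have hζd : HasFDerivAt ζ ((fderiv ℝ π (ψ z)).comp (fderiv ℝ ψ z)) z := hπz.comp z hψd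
    set L := (fderiv ℝ π (ψ z)).comp (fderiv ℝ ψ z)
    have hgd : HasFDerivAt g (fderiv ℝ g (ζ z)) (ζ z) :=
      ((hg _ (hζU z).1).differentiableAt (by simp)).hasFDerivAt
    have hgL : fderiv ℝ ψ z = (fderiv ℝ g (ζ z)).comp L := by
      have h1 := hgd.comp z hζd
      rw [show g ∘ ζ = ψ from funext fun y => (hζU y).2] at h1
      exact hψd.unique h1
    -- `ψ` and `g` both intertwine `i` with `𝒥`, and `dψ = dg ∘ L` with `dg` injective.
    have hLI : ∀ v, L (Complex.I * v) = Complex.I * L v := fun v => by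
      apply hinj _ (hζU z).1
      have h1 := (he2 z hz).2 v
      change fderiv ℝ ψ z _ = 𝒥 (ψ z) (fderiv ℝ ψ z v) at h1
      rw [h𝒥 _ (hζU z).1, (hζU z).2]
      rw [hgL] at h1
      exact h1
    have hζc : DifferentiableAt ℂ ζ z := by
      refine differentiableAt_complex_iff_differentiableAt_real.2 ⟨hζd.differentiableAt, ?_⟩
      rw [hζd.fderiv]
      simpa using hLI 1
    refine ⟨deriv ζ z, fun h0 => ?_, hζc.hasDerivAt⟩
    have h1 : L = 0 := by
      have h2 := hζc.hasDerivAt.hasFDerivAt.restrictScalars ℝ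
      rw [hζd.unique h2, h0]
      ext; simp
    have h2 : fderiv ℝ ψ z 1 = fderiv ℝ ψ z 0 := by rw [hgL, h1]; simp
    exact one_ne_zero ((he2 z hz).1 h2)
  let cs : ChartedSpace ℂ (g '' (U : Set ℂ)) :=
    { atlas := complexCharts (g '' (U : Set ℂ)) 𝒥
      chartAt := fun _ => e₀
      mem_chart_source := fun _ => Set.mem_univ _
      chart_mem_atlas := fun _ => hmem }
  have hman : IsManifold (modelWithCornersSelf ℂ ℂ) (⊤ : WithTop ℕ∞) (g '' (U : Set ℂ)) := by
    refine isManifold_of_contDiffOn _ _ _ fun e e' he he' => ?_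
    -- Passing through `e₀`, the transition map is the inverse of `e₀ ∘ e'⁻¹` applied after `e₀ ∘
    -- e⁻¹`; the inverse is differentiable since the derivative is nonzero.
    have hd : DifferentiableOn ℂ (e.symm.trans e') (e.symm.trans e').source := by
      intro z hz
      rw [OpenPartialHomeomorph.trans_source] at hz
      have hz1 : z ∈ e.target := hz.1
      have hz2 : e.symm z ∈ e'.source := hz.2
      obtain ⟨d, -, hd⟩ := hcoord e he z hz1
      set F' := e'.symm.trans e₀ with hF'
      obtain ⟨d', hd'0, hd'⟩ := hcoord e' he' (e' (e.symm z)) (e'.map_source hz2)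
      have hinv : ∀ x, e₀.symm (e₀ x) = x := fun x => e₀.left_inv (Set.mem_univ x)
      have h1 : F'.symm (e₀ (e.symm z)) = e' (e.symm z) := by
        rw [hF', OpenPartialHomeomorph.trans_symm_eq_symm_trans_symm]
        simp [hinv]
      have h2 : e₀ (e.symm z) ∈ F'.target := by
        rw [← OpenPartialHomeomorph.symm_source, hF',
          OpenPartialHomeomorph.trans_symm_eq_symm_trans_symm,
          OpenPartialHomeomorph.trans_source]
        refine ⟨e₀.map_source (Set.mem_univ _), ?_⟩
        simpa [hinv] using hz2
      have h3 : HasDerivAt F'.symm d'⁻¹ (e₀ (e.symm z)) :=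
        F'.hasDerivAt_symm h2 hd'0 (by rwa [h1])
      have h4 := HasDerivAt.comp z (h₂ := F'.symm) (h := e.symm.trans e₀) h3 hd
      have h5 : F'.symm ∘ e.symm.trans e₀ = e.symm.trans e' := by
        ext y
        rw [hF', OpenPartialHomeomorph.trans_symm_eq_symm_trans_symm]
        simp [hinv]
      rw [h5] at h4
      exact h4.differentiableAt.differentiableWithinAt
    have hc : ContDiffOn ℂ (⊤ : WithTop ℕ∞) (e.symm.trans e') (e.symm.trans e').source :=
      hd.contDiffOn (e.symm.trans e').open_source
    simpa using hc
  have hmax : e₀ ∈ IsManifold.maximalAtlas (modelWithCornersSelf ℂ ℂ) (⊤ : WithTop ℕ∞)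
      (g '' (U : Set ℂ)) := IsManifold.subset_maximalAtlas hmem
  refine ⟨cs, rfl, hman, ⟨⟨fun z => e₀.symm z, fun x => ⟨e₀ x, e₀.map_source (Set.mem_univ x)⟩,
    fun z => Subtype.ext (e₀.right_inv z.2), fun x => e₀.left_inv (Set.mem_univ x)⟩, ?_, ?_⟩,
    fun z => hsymm z z.2⟩
  · exact (contMDiffOn_symm_of_mem_maximalAtlas hmax).comp_contMDiff contMDiff_subtype_val
      fun z => z.2
  · have he : ContMDiff (modelWithCornersSelf ℂ ℂ) (modelWithCornersSelf ℂ ℂ)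
        (⊤ : WithTop ℕ∞) e₀ := contMDiffOn_univ.1 (contMDiffOn_of_mem_maximalAtlas hmax)
    exact fun x => (ChartedSpace.liftPropWithinAt_subtypeVal_comp_iff
      (fun x => (⟨e₀ x, e₀.map_source (Set.mem_univ x)⟩ : U)) _ x).1 (he x)

end Biholomorphism

end Slice

namespace Slice

open Octonion Filter Topology

/-! ### Geometry of the wing. -/

section WingGeometry

variable {D : Set ℂ} {f : Octonion → Octonion} {c : Octonion} {G : ℂ → OctonionC}
  {z : ℂ} {I J : Octonion}

theorem IsWingStem.existsUnique_isWingData (hD : IsProductBase D) (hG : IsWingStem D f c G)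
    (hz : z ∈ upper D) (hJ : J ∈ imUnits) :
    ∃! p : Octonion × Octonion, IsWingData D f c z J p.1 p.2 := by
  obtain ⟨n, H, hH⟩ := hG.exists_isStemFactor hD hz
  refine ⟨(phiC J (fderiv ℝ H z 1), z.im⁻¹ • (H z).2),
    (hG.isWingData_iff hD hz hJ hH).2 ⟨rfl, rfl⟩, fun p hp => ?_⟩
  obtain ⟨h1, h2⟩ := (hG.isWingData_iff hD hz hJ hH).1 hp
  exact Prod.ext h1 h2

theorem IsWingStem.data_snd_ne_zero (hD : IsProductBase D) (hG : IsWingStem D f c G)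
    (hz : z ∈ upper D) (hJ : J ∈ imUnits) {a b : Octonion} (hab : IsWingData D f c z J a b) :
    b ≠ 0 := by
  obtain ⟨n, H, hH⟩ := hG.exists_isStemFactor hD hz
  rw [((hG.isWingData_iff hD hz hJ hH).1 hab).2]
  exact smul_ne_zero (inv_ne_zero hz.2.ne') (hG.snd_ne_zero hD hz hH)

theorem IsWingStem.wingStructure_eq (hD : IsProductBase D) (hG : IsWingStem D f c G)
    (hz : z ∈ upper D) (hJ : J ∈ imUnits) {a b : Octonion} (hab : IsWingData D f c z J a b)
    (v : Octonion) : wingStructure D f c (phi J z) v = (J * (v * b)) * b⁻¹ := by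
  have h1 : (⟨(phi J z).re, ‖(phi J z).im‖⟩ : ℂ) = z := proj_phi hJ hz.2
  have h2 : ‖(phi J z).im‖⁻¹ • (phi J z).im = J := by
    rw [norm_im_phi hJ, im_phi hJ, abs_of_pos hz.2, smul_smul, inv_mul_cancel₀ hz.2.ne', one_smul]
  have h3 : (Classical.epsilon fun p : Octonion × Octonion => IsWingData D f c z J p.1 p.2) =
      (a, b) :=
    (hG.existsUnique_isWingData hD hz hJ).unique
      (Classical.epsilon_spec (p := fun p : Octonion × Octonion => IsWingData D f c z J p.1 p.2)
        ⟨(a, b), hab⟩) hab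
  simp only [wingStructure, h1, h2, h3]

theorem IsWingStem.fderiv_wingMap (hD : IsProductBase D) (hG : IsWingStem D f c G)
    (hz : z ∈ upper D) (hI : I ∈ imUnits) {a b : Octonion} (hJ : J ∈ imUnits)
    (hzJ : wingMap D f c I z = phi J z) (hab : IsWingData D f c z J a b) (v : ℂ) :
    fderiv ℝ (wingMap D f c I) z v = (phi J v * (b - a)) * b⁻¹ := by
  rw [← hG.fderiv_wingMap_mul hD hz hI hJ hzJ hab, mul_mul_inv _ (hG.data_snd_ne_zero hD hz hJ hab)]

theorem IsWingStem.proj_wingMap (hD : IsProductBase D) (hG : IsWingStem D f c G)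
    (hz : z ∈ upper D) (hI : I ∈ imUnits) : proj (wingMap D f c I z) = z := by
  obtain ⟨J, hJ, h⟩ := hG.exists_wingMap_eq hD hz hI
  rw [h, proj_phi hJ hz.2]

theorem IsWingStem.re_fderiv_wingMap (hD : IsProductBase D) (hG : IsWingStem D f c G)
    (hz : z ∈ upper D) (hI : I ∈ imUnits) (v : ℂ) :
    (fderiv ℝ (wingMap D f c I) z v).re = v.re := by
  have h1 : HasFDerivAt (wingMap D f c I) (fderiv ℝ (wingMap D f c I) z) z :=
    ((hG.contDiffAt_wingMap hD hz hI).differentiableAt (by simp)).hasFDerivAt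
  have h2 := reL.hasFDerivAt.comp z h1
  have h3 : reL ∘ wingMap D f c I =ᶠ[𝓝 z] Complex.reCLM := by
    filter_upwards [(isOpen_upper hD.isOpen).mem_nhds hz] with y hy
    exact congrArg Complex.re (hG.proj_wingMap hD hy hI)
  have h4 := (h2.congr_of_eventuallyEq h3.symm).unique Complex.reCLM.hasFDerivAt
  exact congrArg (fun T => T v) h4

/-- If `a = b` then `dω = 0`, whereas `re ω(z) = re z` forces `re dω(1) = 1`. -/
theorem IsWingStem.data_ne (hD : IsProductBase D) (hG : IsWingStem D f c G)
    (hz : z ∈ upper D) (hI : I ∈ imUnits) {a b : Octonion} (hJ : J ∈ imUnits)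
    (hzJ : wingMap D f c I z = phi J z) (hab : IsWingData D f c z J a b) : a ≠ b := by
  rintro rfl
  have h := hG.re_fderiv_wingMap hD hz hI 1
  rw [hG.fderiv_wingMap hD hz hI hJ hzJ hab, sub_self, mul_zero, zero_mul] at h
  simp at h

/-- A kernel vector satisfies `φ_J(v) (b - a) = 0`, and `𝕆` has no zero divisors. -/
theorem IsWingStem.fderiv_wingMap_injective (hD : IsProductBase D) (hG : IsWingStem D f c G)
    (hz : z ∈ upper D) (hI : I ∈ imUnits) :
    Function.Injective (fderiv ℝ (wingMap D f c I) z) := by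
  obtain ⟨J, hJ, hzJ⟩ := hG.exists_wingMap_eq hD hz hI
  obtain ⟨⟨a, b⟩, hab, -⟩ := hG.existsUnique_isWingData hD hz hJ
  rw [injective_iff_map_eq_zero]
  intro v hv
  have h1 := hG.fderiv_wingMap_mul hD hz hI hJ hzJ hab v
  rw [hv, zero_mul, eq_comm, mul_eq_zero'] at h1
  have h2 := h1.resolve_right (sub_ne_zero.2 (hG.data_ne hD hz hI hJ hzJ hab).symm)
  have h3 : v.re = 0 := by rw [← re_phi hJ, h2, re_zero]
  have h4 : |v.im| = 0 := by
    rw [← norm_im_phi hJ, h2]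
    simp [im]
  exact Complex.ext h3 (abs_eq_zero.1 h4)

theorem IsWingStem.fderiv_wingMap_I_mul (hD : IsProductBase D) (hG : IsWingStem D f c G)
    (hz : z ∈ upper D) (hI : I ∈ imUnits) (v : ℂ) :
    fderiv ℝ (wingMap D f c I) z (Complex.I * v) =
      wingStructure D f c (wingMap D f c I z) (fderiv ℝ (wingMap D f c I) z v) := by
  obtain ⟨J, hJ, hzJ⟩ := hG.exists_wingMap_eq hD hz hI
  obtain ⟨⟨a, b⟩, hab, -⟩ := hG.existsUnique_isWingData hD hz hJ
  rw [hzJ, hG.wingStructure_eq hD hz hJ hab, hG.fderiv_wingMap_mul hD hz hI hJ hzJ hab,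
    hG.fderiv_wingMap hD hz hI hJ hzJ hab, phi_mul_comm_I hJ]

theorem IsWingStem.im_wingMap_ne_zero (hD : IsProductBase D) (hG : IsWingStem D f c G)
    (hz : z ∈ upper D) (hI : I ∈ imUnits) : (wingMap D f c I z).im ≠ 0 := by
  obtain ⟨J, hJ, h⟩ := hG.exists_wingMap_eq hD hz hI
  rw [h, im_phi hJ]
  exact smul_ne_zero hz.2.ne' (ne_zero_of_mem_imUnits hJ)

theorem IsWingStem.tangentAt_wing (hD : IsProductBase D) (hG : IsWingStem D f c G)
    (hz : z ∈ upper D) (hI : I ∈ imUnits) :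
    tangentAt (wing D f c I) (wingMap D f c I z) = Set.range (fderiv ℝ (wingMap D f c I) z) :=
  tangentAt_image (isOpen_upper hD.isOpen) hz ((hG.contDiffAt_wingMap hD hz hI).of_le le_top)
    (contDiffAt_proj (hG.im_wingMap_ne_zero hD hz hI)) fun _ hy => hG.proj_wingMap hD hy hI

theorem IsWingStem.isAnalyticEmbedding (hD : IsProductBase D) (hG : IsWingStem D f c G)
    (hI : I ∈ imUnits) : IsAnalyticEmbedding (upper D) (wingMap D f c I) := by
  refine ⟨fun z hz => (hG.contDiffAt_wingMap hD hz hI).analyticAt, fun z hz =>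
    hG.fderiv_wingMap_injective hD hz hI, ?_⟩
  have h1 : Continuous ((upper D).domRestrict (wingMap D f c I)) :=
    continuousOn_iff_continuous_domRestrict.1 fun z hz =>
      (hG.contDiffAt_wingMap hD hz hI).continuousAt.continuousWithinAt
  refine Topology.IsEmbedding.of_comp h1 continuous_proj ?_
  have h2 : proj ∘ (upper D).domRestrict (wingMap D f c I) = Subtype.val :=
    funext fun z => hG.proj_wingMap hD z.2 hI
  rw [h2]
  exact Topology.IsEmbedding.subtypeVal

theorem IsWingStem.wing_inter_sphere (hD : IsProductBase D) (hG : IsWingStem D f c G)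
    (hz : z ∈ upper D) (hI : I ∈ imUnits) :
    wing D f c I ∩ sphere z = {wingMap D f c I z} := by
  ext x
  constructor
  · rintro ⟨⟨y, hy, rfl⟩, K, hK, h⟩
    have h1 : y = z := by rw [← hG.proj_wingMap hD hy hI, h, proj_phi hK hz.2]
    rw [h1]
    rfl
  · rintro rfl
    exact ⟨⟨z, hz, rfl⟩, hG.exists_wingMap_eq hD hz hI⟩

/-- The sphere is tangent to the orthogonal complement of `ℂ_J`, so `dω(p + iq)` need only have
components `p`, `q` along `1`, `J`. -/
theorem IsWingStem.transverseAt (hD : IsProductBase D) (hG : IsWingStem D f c G)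
    (hz : z ∈ upper D) (hI : I ∈ imUnits) :
    TransverseAt (wing D f c I) (sphere z) (wingMap D f c I z) := by
  obtain ⟨J, hJ, hzJ⟩ := hG.exists_wingMap_eq hD hz hI
  obtain ⟨⟨a, b⟩, hab, -⟩ := hG.existsUnique_isWingData hD hz hJ
  have hT := hG.tangentAt_wing hD hz hI
  rw [hzJ] at hT ⊢
  refine transverseAt_sphere hJ hz.2.ne' fun p q => ?_
  refine ⟨fderiv ℝ (wingMap D f c I) z ⟨p, q⟩, ?_, hG.re_fderiv_wingMap hD hz hI _, ?_⟩
  · rw [hT]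
    exact ⟨_, rfl⟩
  · have h1 : HasFDerivAt (wingMap D f c I) (fderiv ℝ (wingMap D f c I) z) z :=
      ((hG.contDiffAt_wingMap hD hz hI).differentiableAt (by simp)).hasFDerivAt
    -- Differentiating `‖im ω‖² = β²` at `z`, where `im ω = β J`, gives the component along `J`.
    have h2 := (imL.hasFDerivAt.comp z h1).norm_sq
    have h3 : (fun y => ‖(imL ∘ wingMap D f c I) y‖ ^ 2) =ᶠ[𝓝 z] fun y => y.im ^ 2 := by
      filter_upwards [(isOpen_upper hD.isOpen).mem_nhds hz] with y hy
      have := congrArg Complex.im (hG.proj_wingMap hD hy hI)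
      change ‖(wingMap D f c I y).im‖ = y.im at this
      rw [Function.comp_apply, imL_apply, this]
    have h4 := (h2.congr_of_eventuallyEq h3.symm).unique
      ((Complex.imCLM.hasFDerivAt (x := z)).pow 2)
    have h5 := congrArg (fun T => T (⟨p, q⟩ : ℂ)) h4
    have h6 : 2 * inner ℝ (phi J z).im (fderiv ℝ (wingMap D f c I) z ⟨p, q⟩).im =
        2 * (z.im * q) := by
      rw [← hzJ]
      simpa [mul_assoc] using h5
    have h7 : inner ℝ J (1 : Octonion) = (0 : ℝ) := by
      rw [inner_one, re_of_mem_imUnits hJ]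
    rw [im_phi hJ, inner_smul_left, im, inner_sub_right, inner_smul_right, h7, mul_zero,
      sub_zero, conj_trivial] at h6
    exact mul_left_cancel₀ hz.2.ne' (mul_left_cancel₀ two_ne_zero h6)

end WingGeometry

end Slice

theorem mainTheorem11 (D : Set ℂ) (hD : Slice.IsProductBase D)
    (f : Octonion → Octonion) (c : Octonion) (hf : Slice.AdmitsWing D f c)
    (I : Octonion) (hI : I ∈ Octonion.imUnits)
    (ω : ℂ → Octonion) (hω : ω = Slice.wingMap D f c I)
    (W : Set Octonion) (hW : W = Slice.wing D f c I)
    (𝒥 : Octonion → Octonion → Octonion) (h𝒥 : 𝒥 = Slice.wingStructure D f c) :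
    -- the map is well defined: it depends neither on `I` nor on the factorization of `f - c`
    ((∀ I' ∈ Octonion.imUnits, Set.EqOn (Slice.wingMap D f c I') ω (Slice.upper D)) ∧
      (∀ z ∈ Slice.upper D, Slice.sphDeriv f (Slice.phi I z) = 0 →
        (∃ n h, Slice.IsWingFactor D f c z I n h) ∧
        ∀ n h, Slice.IsWingFactor D f c z I n h →
          ω z = z.re • (1 : Octonion) -
            Slice.sphValue h (Slice.phi I z) * (Slice.sphDeriv h (Slice.phi I z))⁻¹) ∧
      Set.MapsTo ω (Slice.upper D) (Slice.circ D) ∧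
      (∀ x ∈ W, f x = c) ∧
      {x ∈ Slice.circ D | f x = c} \ Slice.degSet D f = W \ Slice.degSet D f) ∧
    -- embedding and transversality to the spheres
    (Slice.IsAnalyticEmbedding (Slice.upper D) ω ∧
      ∀ z ∈ Slice.upper D, W ∩ Slice.sphere z = {ω z} ∧
        Slice.TransverseAt W (Slice.sphere z) (ω z)) ∧
    -- the differential, at `x = α + β J` in the wing
    (∀ z ∈ Slice.upper D, ∀ J ∈ Octonion.imUnits, Slice.phi J z ∈ W →
      (∃! p : Octonion × Octonion, Slice.IsWingData D f c z J p.1 p.2) ∧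
      Slice.tangentAt W (Slice.phi J z) = Set.range (fderiv ℝ ω z) ∧
      ∀ a b, Slice.IsWingData D f c z J a b →
        b ≠ 0 ∧ a ≠ b ∧
        fderiv ℝ ω z 1 = 1 - a * b⁻¹ ∧
        fderiv ℝ ω z Complex.I = J - (J * a) * b⁻¹ ∧
        1 - a * b⁻¹ ∈ Slice.tangentAt W (Slice.phi J z) ∧
        J - (J * a) * b⁻¹ ∈ Slice.tangentAt W (Slice.phi J z) ∧
        ∀ v, 𝒥 (Slice.phi J z) v = (J * (v * b)) * b⁻¹) ∧
    -- the complex structure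
    ((∀ x ∈ W, ∀ v ∈ Slice.tangentAt W x,
        𝒥 x v ∈ Slice.tangentAt W x ∧ 𝒥 x (𝒥 x v) = -v) ∧
      (∀ z ∈ Slice.upper D, ∀ v : ℂ,
        fderiv ℝ ω z (Complex.I * v) = 𝒥 (ω z) (fderiv ℝ ω z v)) ∧
      Slice.IsBiholomorphism (Slice.upperOpens hD) W 𝒥 ω) := by
  obtain ⟨G, hG⟩ := hf.exists_isWingStem hD hI
  subst hω hW h𝒥
  have hdata : ∀ z ∈ Slice.upper D, ∀ J ∈ Octonion.imUnits, Slice.phi J z ∈ Slice.wing D f c I →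
      Slice.wingMap D f c I z = Slice.phi J z := by
    rintro z hz J hJ ⟨y, hy, h⟩
    have h1 : y = z := by rw [← hG.proj_wingMap hD hy hI, h, Slice.proj_phi hJ hz.2]
    rw [← h1, h, h1]
  refine ⟨⟨fun I' hI' z hz => ?_, fun z hz h0 => ⟨?_, fun n h hh => ?_⟩, fun z hz => ?_, ?_, ?_⟩,
    ⟨hG.isAnalyticEmbedding hD hI, fun z hz =>
      ⟨hG.wing_inter_sphere hD hz hI, hG.transverseAt hD hz hI⟩⟩,
    fun z hz J hJ hzJ => ⟨hG.existsUnique_isWingData hD hz hJ, ?_, fun a b hab => ?_⟩,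
    ⟨?_, fun z hz => hG.fderiv_wingMap_I_mul hD hz hI, ?_⟩⟩
  · obtain ⟨n, H, hH⟩ := hG.exists_isStemFactor hD hz
    rw [hG.wingMap_eq hD hz hI hH, hG.wingMap_eq hD hz hI' hH]
  · exact hG.exists_isWingFactor hD hz hI ((hG.sphDeriv_eq_zero_iff hz hI).1 h0)
  · obtain ⟨m, H, hH⟩ := hG.exists_isStemFactor hD hz
    rw [hG.wingMap_eq hD hz hI hH, hG.eq_phi_of_isWingFactor hD hz hI hH hh]
  · obtain ⟨J, hJ, h⟩ := hG.exists_wingMap_eq hD hz hI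
    rw [h]
    exact Slice.phi_mem_circ hz.1 hJ
  · rintro x ⟨z, hz, rfl⟩
    exact hG.apply_wingMap hD hz hI
  · ext x
    constructor
    · rintro ⟨⟨hx, hfx⟩, hdeg⟩
      obtain ⟨z, hz, J, hJ, rfl⟩ := Slice.exists_upper_of_mem_circ hD hx
      refine ⟨⟨z, hz, (hG.eq_wingMap hD hz hI hJ (fun h => hdeg ?_) hfx).symm⟩, hdeg⟩
      exact (hG.mem_degSet_iff hz hJ).2 h
    · rintro ⟨⟨z, hz, rfl⟩, hdeg⟩
      refine ⟨⟨?_, hG.apply_wingMap hD hz hI⟩, hdeg⟩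
      obtain ⟨J, hJ, h⟩ := hG.exists_wingMap_eq hD hz hI
      rw [h]
      exact Slice.phi_mem_circ hz.1 hJ
  · rw [← hdata z hz J hJ hzJ]
    exact hG.tangentAt_wing hD hz hI
  · have hzJ' := hdata z hz J hJ hzJ
    have hb := hG.data_snd_ne_zero hD hz hJ hab
    have hbb : b * b⁻¹ = 1 := by simpa using Octonion.mul_mul_inv 1 hb
    have h1 : fderiv ℝ (Slice.wingMap D f c I) z 1 = 1 - a * b⁻¹ := by
      rw [hG.fderiv_wingMap hD hz hI hJ hzJ' hab]
      simp [Slice.phi, sub_mul, hbb]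
    have h2 : fderiv ℝ (Slice.wingMap D f c I) z Complex.I = J - (J * a) * b⁻¹ := by
      rw [hG.fderiv_wingMap hD hz hI hJ hzJ' hab]
      simp [Slice.phi, sub_mul, mul_sub, Octonion.mul_mul_inv J hb]
    refine ⟨hb, hG.data_ne hD hz hI hJ hzJ' hab, h1, h2, ?_, ?_,
      hG.wingStructure_eq hD hz hJ hab⟩
    · rw [← hzJ', hG.tangentAt_wing hD hz hI, ← h1]
      exact ⟨_, rfl⟩
    · rw [← hzJ', hG.tangentAt_wing hD hz hI, ← h2]
      exact ⟨_, rfl⟩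
  · rintro x ⟨z, hz, rfl⟩ v hv
    rw [hG.tangentAt_wing hD hz hI] at hv ⊢
    obtain ⟨u, rfl⟩ := hv
    -- On tangent vectors `𝒥` is multiplication by `i` transported by `dω`, so invariance and `𝒥² =
    -- -1` come from `ℂ`.
    rw [← hG.fderiv_wingMap_I_mul hD hz hI, ← hG.fderiv_wingMap_I_mul hD hz hI]
    refine ⟨⟨_, rfl⟩, ?_⟩
    rw [← mul_assoc, Complex.I_mul_I, neg_one_mul, map_neg]
  · exact Slice.isBiholomorphism_image (U := Slice.upperOpens hD) hD.connected.nonempty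
      (fun z hz => (hG.contDiffAt_wingMap hD hz hI).of_le le_top)
      (fun z hz => hG.fderiv_wingMap_injective hD hz hI) Slice.continuous_proj
      (fun z hz => Slice.contDiffAt_proj (hG.im_wingMap_ne_zero hD hz hI))
      (fun z hz => hG.proj_wingMap hD hz hI) _
      (fun z hz => hG.fderiv_wingMap_I_mul hD hz hI)
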